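/- Let $n\ge 2$, let $\Omega\subset\mathbb R^2$ be open, and let $A\in\mathcal C^1(\Omega,\mathbb C^{n\times n})$ be such that, for every $\xi\in\Omega$, the singular values $\sigma_1(A(\xi))\ge\dots\ge\sigma_n(A(\xi))\ge 0$ are distinct. Let $\xi_0\in\Omega$ be the only point of $\Omega$ where $A$ loses rank, i.e. for $\xi\in\Omega$, $\operatorname{rank}A(\xi)<n$ if and only if $\xi=\xi_0$. For $\eta=(\xi,\varepsilon)\in\Omega\times\mathbb R\subset\mathbb R^3$ put $$M(\eta)=\begin{bmatrix}\varepsilon I & A(\xi)\\ A(\xi)^* & -\varepsilon I\end{bmatrix}\in\mathbb C^{2n\times 2n}.$$ Then $\xi_0$ is a generic point of loss of rank for $A$ if and only if $\eta_0=(\xi_0,0)$ is a generic point of coalescence for the eigenvalues of the Hermitian function $M$ on $\Omega\times\mathbb R$. Here the following terms are used. A point $v$ is a *regular zero* of a map $F$ between open subsets of Euclidean spaces of equal dimension if $F(v)=0$ and the derivative of $F$ at $v$ exists and is invertible. The point $\xi_0$ is a *generic point of loss of rank* for $A$ if it is a regular zero of $\xi\mapsto(\operatorname{Re}\det A(\xi),\operatorname{Im}\det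 A(\xi))\in\mathbb R^2$. Let $B\in\mathcal C^1(D,\mathbb C^{m\times m})$ be Hermitian on an open set $D\subset\mathbb R^3$, with eigenvalues $\lambda_1(\eta)\ge\dots\ge\lambda_m(\eta)$. A point $\eta_0\in D$ is a *generic point of coalescence* for the eigenvalues of $B$ if there is an index $h$ with $1\le h<m$ such that, for $1\le j<m$ and $\eta\in D$, $\lambda_j(\eta)=\lambda_{j+1}(\eta)$ if and only if $j=h$ and $\eta=\eta_0$, and moreover: (i) if $m=2$ and $B=\begin{bmatrix}a&b+ic\\b-ic&d\end{bmatrix}$ with $a,b,c,d$ real valued, then $\eta_0$ is a regular zero of $F=(a-d,\,b,\,c)$; (ii) if $m>2$, then there is a $\mathcal C^1$ block Schur decomposition $B=U\begin{bmatrix}P&0\\0&\Lambda\end{bmatrix}U^*$ on some product $R\subset D$ of three intervals with $\eta_0$ in its interior, where $U$ is unitary, $P$ is a $2\times 2$ matrix function with eigenvalues $\lambda_h,\lambda_{h+1}$, and $\Lambda=\operatorname{diag}(\lambda_1,\dots,\lambda_{h-1},\lambda_{h+2},\dots,\lambda_m)$; and, for every such decomposition, $\eta_0$ is a regular zero of the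 map $F$ of (i) formed from $P$. -/

import Mathlib

open Matrix

noncomputable section

/-- The two-dimensional parameter space `ℝ²`, with points `ξ = (x, y)`. -/
abbrev Plane : Type := ℝ × ℝ

/-- The three-dimensional parameter space `ℝ³ = ℝ² × ℝ`, with points `((x, y), z)`. -/
abbrev Space : Type := (ℝ × ℝ) × ℝ

/-- `A ∈ C¹(Ω, ℂ^{m × n})`: every entry is continuously differentiable on `Ω`
(as a function of real variables). -/
def MatrixC1On {E : Type*} [NormedAddCommGroup E] [NormedSpace ℝ E] {ι κ : Type*}
    (Ω : Set E) (A : E → Matrix ι κ ℂ) : Prop :=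
  ∀ i j, ContDiffOn ℝ 1 (fun ξ => A ξ i j) Ω

/-- `v` is a regular zero of `F`: `F v = 0` and the derivative of `F` at `v` exists and is
invertible. -/
def IsRegularZero {E G : Type*} [NormedAddCommGroup E] [NormedSpace ℝ E]
    [NormedAddCommGroup G] [NormedSpace ℝ G] (F : E → G) (v : E) : Prop :=
  F v = 0 ∧ ∃ F' : E ≃L[ℝ] G, HasFDerivAt F (F' : E →L[ℝ] G) v

/-- The `n` singular values of `A ∈ ℂ^{n × n}`, listed in decreasing order. -/
def singVal {n : ℕ} (A : Matrix (Fin n) (Fin n) ℂ) (j : Fin n) : ℝ :=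
  (Matrix.toEuclideanLin A).singularValues j

/-- `ξ₀` is a generic point of loss of rank for `A`: it is a regular zero of
`ξ ↦ (Re det A(ξ), Im det A(ξ))`. -/
def IsGenericLossOfRank {n : ℕ} (A : Plane → Matrix (Fin n) (Fin n) ℂ) (ξ₀ : Plane) : Prop :=
  IsRegularZero (fun ξ => (((A ξ).det.re, (A ξ).det.im) : ℝ × ℝ)) ξ₀

/-- The eigenvalues `λ_0 ≥ ⋯ ≥ λ_{m-1}` of a Hermitian matrix, in decreasing order. -/
def eig {m : ℕ} {B : Matrix (Fin m) (Fin m) ℂ} (hB : B.IsHermitian) (j : Fin m) : ℝ :=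
  hB.eigenvalues₀ (Fin.cast (Fintype.card_fin m).symm j)

/-- For a Hermitian `P = [[a, b + i c], [b - i c, d]]`, the vector `(a - d, b, c)`. -/
def coalescenceMap (P : Matrix (Fin 2) (Fin 2) ℂ) : ℝ × ℝ × ℝ :=
  ((P 0 0).re - (P 1 1).re, (P 0 1).re, (P 0 1).im)

/-- A product of three intervals of `ℝ` (of any kind). -/
def IsPluriRectangle (R : Set Space) : Prop :=
  ∃ I J K : Set ℝ, I.OrdConnected ∧ J.OrdConnected ∧ K.OrdConnected ∧ R = (I ×ˢ J) ×ˢ K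

/-- `λ_j(ξ) = λ_{j+1}(ξ)` with `ξ ∈ Ω` if and only if `j = h` and `ξ = ξ₀` (indices from `0`). -/
def CoalesceOnlyAt {m : ℕ} (Ω : Set Space) (A : Space → Matrix (Fin m) (Fin m) ℂ)
    (hA : ∀ ξ ∈ Ω, (A ξ).IsHermitian) (h : ℕ) (ξ₀ : Space) : Prop :=
  ∀ (j : ℕ) (hj : j + 1 < m) (ξ : Space) (hξ : ξ ∈ Ω),
    eig (hA ξ hξ) ⟨j, Nat.lt_of_succ_lt hj⟩ = eig (hA ξ hξ) ⟨j + 1, hj⟩ ↔ j = h ∧ ξ = ξ₀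

/-- A `C¹` block Schur decomposition `A = U [[P, 0], [0, Λ]] U*` on a pluri-rectangle `R ⊆ Ω`
having `ξ₀` in its interior: `U` is unitary, `P` is `2 × 2` with eigenvalues `λ_h, λ_{h+1}`, and
`Λ` is the diagonal matrix of the remaining eigenvalues in decreasing order. -/
structure IsBlockSchur {m : ℕ} (Ω : Set Space) (A : Space → Matrix (Fin m) (Fin m) ℂ)
    (hA : ∀ ξ ∈ Ω, (A ξ).IsHermitian) (h : ℕ) (hh : h + 1 < m) (ξ₀ : Space) (R : Set Space)
    (U : Space → Matrix (Fin m) (Fin 2 ⊕ {i : Fin m // (i : ℕ) ≠ h ∧ (i : ℕ) ≠ h + 1}) ℂ)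
    (P : Space → Matrix (Fin 2) (Fin 2) ℂ)
    (L : Space → Matrix {i : Fin m // (i : ℕ) ≠ h ∧ (i : ℕ) ≠ h + 1}
      {i : Fin m // (i : ℕ) ≠ h ∧ (i : ℕ) ≠ h + 1} ℂ) : Prop where
  rectangle : IsPluriRectangle R
  subset : R ⊆ Ω
  mem_interior : ξ₀ ∈ interior R
  smooth_U : MatrixC1On R U
  smooth_P : MatrixC1On R P
  smooth_L : MatrixC1On R L
  unitary_left : ∀ ξ ∈ R, (U ξ)ᴴ * U ξ = 1
  unitary_right : ∀ ξ ∈ R, U ξ * (U ξ)ᴴ = 1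
  decomp : ∀ ξ ∈ R, A ξ = U ξ * Matrix.fromBlocks (P ξ) 0 0 (L ξ) * (U ξ)ᴴ
  eig_L : ∀ (ξ : Space) (hξ : ξ ∈ R),
    L ξ = Matrix.diagonal fun i => ((eig (hA ξ (subset hξ)) i.1 : ℝ) : ℂ)
  eig_P : ∀ (ξ : Space) (hξ : ξ ∈ R),
    (P ξ).charpoly.roots =
      {((eig (hA ξ (subset hξ)) ⟨h, Nat.lt_of_succ_lt hh⟩ : ℝ) : ℂ),
        ((eig (hA ξ (subset hξ)) ⟨h + 1, hh⟩ : ℝ) : ℂ)}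

/-- `ξ₀ ∈ Ω` is a generic point of coalescence for the eigenvalues of the Hermitian function `A`
on `Ω ⊆ ℝ³`: exactly one pair of consecutive eigenvalues coalesces, and only at `ξ₀`; and
* if `m = 2`, `ξ₀` is a regular zero of `(a - d, b, c)` for `A = [[a, b + i c], [b - i c, d]]`;
* if `m > 2`, `ξ₀` is a regular zero of that map for the `2 × 2` block `P` of a `C¹` block Schur
  decomposition of `A` near `ξ₀`. Such a decomposition has to exist, and the condition is imposed
  on all of them, so that it does not hinge on a choice. -/
def IsGenericCoalescence {m : ℕ} (Ω : Set Space) (A : Space → Matrix (Fin m) (Fin m) ℂ)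
    (hA : ∀ ξ ∈ Ω, (A ξ).IsHermitian) (ξ₀ : Space) : Prop :=
  ξ₀ ∈ Ω ∧ ∃ (h : ℕ) (hh : h + 1 < m), CoalesceOnlyAt Ω A hA h ξ₀ ∧
    (∀ hm : m = 2, IsRegularZero
      (fun ξ => coalescenceMap ((A ξ).reindex (finCongr hm) (finCongr hm))) ξ₀) ∧
    (2 < m →
      (∃ R U P L, IsBlockSchur Ω A hA h hh ξ₀ R U P L) ∧
      ∀ R U P L, IsBlockSchur Ω A hA h hh ξ₀ R U P L →
        IsRegularZero (fun ξ => coalescenceMap (P ξ)) ξ₀)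

/-- `M(ξ, ε) = [[ε I, A(ξ)], [A(ξ)*, -ε I]]`, a `2n × 2n` matrix. -/
def hermitianM {n : ℕ} (A : Plane → Matrix (Fin n) (Fin n) ℂ) (η : Space) :
    Matrix (Fin (n + n)) (Fin (n + n)) ℂ :=
  (Matrix.fromBlocks ((η.2 : ℂ) • (1 : Matrix (Fin n) (Fin n) ℂ)) (A η.1)
    (A η.1)ᴴ (-((η.2 : ℂ) • (1 : Matrix (Fin n) (Fin n) ℂ)))).reindex
      finSumFinEquiv finSumFinEquiv

theorem hermitianM_isHermitian {n : ℕ} (A : Plane → Matrix (Fin n) (Fin n) ℂ) (η : Space) :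
    (hermitianM A η).IsHermitian := by
  unfold hermitianM
  rw [Matrix.reindex_apply]
  apply Matrix.IsHermitian.submatrix
  apply Matrix.IsHermitian.fromBlocks
  · simp [Matrix.IsHermitian, Matrix.conjTranspose_smul]
  · simp
  · simp [Matrix.IsHermitian, Matrix.conjTranspose_smul]

end

/-! Distinct singular values make every σ_j² a simple eigenvalue of A*A and of AA*, so near any
point there are C¹ unit eigenvectors of both, hence a factorization A = U diag(s) V* with U, V
unitary, all of class C¹, and |s_j| = σ_j (`exists_local_phasedSVD`). The s_j are complex on
purpose: σ_n itself need not be differentiable where it vanishes, but s_n is.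

Both sides of the equivalence reduce to one condition, injectivity of the derivative of s_n at ξ₀.
On one side, det A is s_n times a C¹ factor that does not vanish at ξ₀
(`isRegularZero_re_im_mul_iff`). On the other, conjugation by diag(U, V) splits M into the blocks
[[ε, s_j], [s̄_j, -ε]] with eigenvalues ±√(ε² + |s_j|²), so the only coalescence is that of the
middle pair at (ξ₀, 0). For j < n the block has s_j ≠ 0 and is diagonalized by a C¹ rotation;
leaving the last block alone gives a block Schur decomposition with P = [[ε, s_n], [s̄_n, -ε]]
(`isBlockSchur_hermitianM`), whose coalescence map is (2ε, Re s_n, Im s_n).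

The definition quantifies over all decompositions, so regularity must not depend on the choice
(`IsBlockSchur.isRegularZero_of`). The coalescence map of P is regular exactly when no nonzero
direction v makes P'(v) a scalar matrix. Two decompositions have P'(v) and P₀'(v) unitarily
conjugate at the point, and conjugation fixes scalar matrices. -/

open Topology Filter

noncomputable section

/-! ### Calculus of C¹ matrix functions. -/

/-- Every entry of the matrix function `A` is continuously differentiable near `x`. -/
def MatrixC1At {E : Type*} [NormedAddCommGroup E] [NormedSpace ℝ E] {ι κ : Type*}
    (A : E → Matrix ι κ ℂ) (x : E) : Prop :=
  ∀ i j, ContDiffAt ℝ 1 (fun ξ => A ξ i j) x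

theorem contDiff_conj : ContDiff ℝ 1 (fun z : ℂ => star z) :=
  Complex.conjCLE.contDiff

theorem contDiff_ofReal : ContDiff ℝ 1 (fun r : ℝ => (r : ℂ)) :=
  Complex.ofRealCLM.contDiff

theorem contDiff_normSq : ContDiff ℝ 1 (fun z : ℂ => Complex.normSq z) := by
  have h1 : ContDiff ℝ 1 (fun z : ℂ => z.re) := Complex.reCLM.contDiff
  have h2 : ContDiff ℝ 1 (fun z : ℂ => z.im) := Complex.imCLM.contDiff
  simp only [Complex.normSq_apply]
  fun_prop

namespace MatrixC1At

variable {E : Type*} [NormedAddCommGroup E] [NormedSpace ℝ E] {ι κ l : Type*} {x : E}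

theorem mul [Fintype κ] {A : E → Matrix ι κ ℂ} {B : E → Matrix κ l ℂ}
    (hA : MatrixC1At A x) (hB : MatrixC1At B x) : MatrixC1At (fun ξ => A ξ * B ξ) x := by
  intro i j
  simp only [Matrix.mul_apply]
  exact ContDiffAt.sum fun k _ => (hA i k).mul (hB k j)

theorem sub {A B : E → Matrix ι κ ℂ}
    (hA : MatrixC1At A x) (hB : MatrixC1At B x) : MatrixC1At (fun ξ => A ξ - B ξ) x :=
  fun i j => (hA i j).sub (hB i j)

theorem conjTranspose {A : E → Matrix ι κ ℂ} (hA : MatrixC1At A x) :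
    MatrixC1At (fun ξ => (A ξ)ᴴ) x :=
  fun i j => contDiff_conj.contDiffAt.comp x (hA j i)

theorem submatrix {ι' κ' : Type*} {A : E → Matrix ι κ ℂ} (hA : MatrixC1At A x)
    (f : ι' → ι) (g : κ' → κ) : MatrixC1At (fun ξ => (A ξ).submatrix f g) x :=
  fun i j => hA (f i) (g j)

theorem diagonal [DecidableEq ι] {d : E → ι → ℂ} (hd : ∀ i, ContDiffAt ℝ 1 (fun ξ => d ξ i) x) :
    MatrixC1At (fun ξ => Matrix.diagonal (d ξ)) x := by
  intro i j
  by_cases h : i = j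
  · subst h
    simpa using hd i
  · simpa [Matrix.diagonal_apply_ne _ h] using contDiffAt_const

theorem fromBlocks {ι' κ' : Type*} {A : E → Matrix ι κ ℂ} {B : E → Matrix ι κ' ℂ}
    {C : E → Matrix ι' κ ℂ} {D : E → Matrix ι' κ' ℂ} (hA : MatrixC1At A x) (hB : MatrixC1At B x)
    (hC : MatrixC1At C x) (hD : MatrixC1At D x) :
    MatrixC1At (fun ξ => Matrix.fromBlocks (A ξ) (B ξ) (C ξ) (D ξ)) x := by
  rintro (i | i) (j | j)
  exacts [hA i j, hB i j, hC i j, hD i j]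

theorem const (A : Matrix ι κ ℂ) : MatrixC1At (fun _ : E => A) x :=
  fun _ _ => contDiffAt_const

theorem det [Fintype ι] [DecidableEq ι] {A : E → Matrix ι ι ℂ} (hA : MatrixC1At A x) :
    ContDiffAt ℝ 1 (fun ξ => (A ξ).det) x := by
  simp only [Matrix.det_apply']
  exact ContDiffAt.sum fun σ _ => contDiffAt_const.mul (contDiffAt_prod fun i _ => hA _ _)

theorem adjugate [Fintype ι] [DecidableEq ι] {A : E → Matrix ι ι ℂ} (hA : MatrixC1At A x) :
    MatrixC1At (fun ξ => (A ξ).adjugate) x := by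
  intro i j
  simp only [Matrix.adjugate_apply]
  refine MatrixC1At.det fun a b => ?_
  simp only [Matrix.updateRow_apply]
  split_ifs
  exacts [contDiffAt_const, hA a b]

theorem comp {F : Type*} [NormedAddCommGroup F] [NormedSpace ℝ F] {A : E → Matrix ι κ ℂ}
    {f : F → E} {y : F} (hA : MatrixC1At A (f y)) (hf : ContDiffAt ℝ 1 f y) :
    MatrixC1At (fun ξ => A (f ξ)) y :=
  fun i j => (hA i j).comp y hf

theorem eventually [Finite ι] [Finite κ] {A : E → Matrix ι κ ℂ} (hA : MatrixC1At A x) :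
    ∀ᶠ y in 𝓝 x, MatrixC1At A y := by
  simp only [MatrixC1At, eventually_all]
  exact fun i j => (hA i j).eventually (by simp)

end MatrixC1At

/-! ### Simple eigenvalues, implicit functions, and ordered spectra. -/

/-- At a simple root of the characteristic polynomial the adjugate of `μ - H` does not vanish. -/
theorem adjugate_ne_zero_of_simple_root {ι : Type*} [Fintype ι] [DecidableEq ι]
    (H : Matrix ι ι ℂ) (μ : ℂ) (h0 : H.charpoly.eval μ = 0)
    (h1 : H.charpoly.derivative.eval μ ≠ 0) : (scalar ι μ - H).adjugate ≠ 0 := by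
  intro hadj
  have hev : (Polynomial.evalRingHom μ).mapMatrix H.charmatrix = scalar ι μ - H := by
    ext i j
    by_cases h : i = j
    · subst h; simp
    · simp [h]
  have hadj' : ∀ i j, (H.charmatrix.adjugate i j).eval μ = 0 := by
    intro i j
    have := congrFun (congrFun ((Polynomial.evalRingHom μ).map_adjugate H.charmatrix) i) j
    rw [hev, hadj] at this
    simpa using this
  -- Differentiate (X - H) adj(X - H) = p(X) I at μ. The term containing adj(μ - H) itself vanishes,
  -- so μ - H would be invertible up to the factor p'(μ) ≠ 0, although its determinant p(μ) is zero.
  have hB : (scalar ι μ - H) *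
      Matrix.of (fun i j => (H.charmatrix.adjugate i j).derivative.eval μ)
      = (H.charpoly.derivative.eval μ) • (1 : Matrix ι ι ℂ) := by
    ext i j
    have key := congrFun (congrFun (mul_adjugate H.charmatrix) i) j
    have key2 := congrArg (fun p => (Polynomial.derivative p).eval μ) key
    simp only [Matrix.mul_apply, Polynomial.derivative_sum, Polynomial.derivative_mul,
      Polynomial.eval_finsetSum, Polynomial.eval_add, Polynomial.eval_mul, hadj', mul_zero,
      zero_add] at key2
    rw [← hev, Matrix.mul_apply]
    refine Eq.trans ?_ (key2.trans ?_)
    · rfl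
    · by_cases h : i = j
      · subst h; simp [Matrix.charpoly]
      · simp [h]
  have := congrArg Matrix.det hB
  rw [det_mul, ← eval_charpoly, h0, zero_mul, det_smul, det_one, mul_one] at this
  exact pow_ne_zero _ h1 this.symm

/-- Scalar implicit function theorem at a simple zero. -/
theorem exists_implicit_root {E : Type*} [NormedAddCommGroup E] [NormedSpace ℝ E]
    [CompleteSpace E] {f : E × ℝ → ℝ} {x : E} {μ d : ℝ} (hf : ContDiffAt ℝ 1 f (x, μ))
    (h0 : f (x, μ) = 0) (hd : HasDerivAt (fun t => f (x, t)) d μ) (hd0 : d ≠ 0) :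
    ∃ φ : E → ℝ, ContDiffAt ℝ 1 φ x ∧ φ x = μ ∧ ∀ᶠ y in 𝓝 x, f (y, φ y) = 0 := by
  have hinv : (fderiv ℝ f (x, μ) ∘L .inr ℝ E ℝ).IsInvertible := by
    refine ⟨ContinuousLinearEquiv.unitsEquivAut ℝ (Units.mk0 d hd0), ?_⟩
    ext
    have h1 : HasDerivAt (fun t : ℝ => (x, t)) ((0 : E), (1 : ℝ)) μ :=
      (hasDerivAt_const μ x).prodMk (hasDerivAt_id μ)
    have h2 := (hf.differentiableAt (by simp)).hasFDerivAt.comp_hasDerivAt μ h1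
    have := hd.unique h2
    simpa using this
  refine ⟨hf.implicitFunction one_ne_zero hinv, hf.contDiffAt_implicitFunction one_ne_zero hinv,
    hf.implicitFunction_apply_self one_ne_zero hinv, ?_⟩
  have := hf.eventually_apply_implicitFunction one_ne_zero hinv
  simpa [h0] using this

theorem im_det_eq_zero_of_isHermitian {ι : Type*} [Fintype ι] [DecidableEq ι] {H : Matrix ι ι ℂ}
    (hH : H.IsHermitian) : H.det.im = 0 := by
  have := det_conjTranspose H
  rw [hH.eq] at this
  exact Complex.conj_eq_iff_im.1 this.symm

/-- The characteristic polynomial of a Hermitian matrix, in terms of the ordered eigenvalues. -/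
theorem charpoly_eq_prod_eig {n : ℕ} {H : Matrix (Fin n) (Fin n) ℂ} (hH : H.IsHermitian) :
    H.charpoly = Lagrange.nodal Finset.univ (fun j => (eig hH j : ℂ)) := by
  rw [hH.charpoly_eq, Lagrange.nodal]
  refine Fintype.prod_equiv ((Fintype.equivOfCardEq (Fintype.card_fin _)).symm.trans
    (finCongr (Fintype.card_fin n))) _ _ fun i => ?_
  simp [eig, IsHermitian.eigenvalues]

theorem eig_antitone {n : ℕ} {H : Matrix (Fin n) (Fin n) ℂ} (hH : H.IsHermitian) :
    Antitone (eig hH) := fun i j hij => hH.eigenvalues₀_antitone (by simpa using hij)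

/-- Both sides come from the sorted eigenvalues of a symmetric operator, so it suffices to identify
the operator of AᴴA with the adjoint composed with A. -/
theorem singVal_eq_sqrt_eig {n : ℕ} (A : Matrix (Fin n) (Fin n) ℂ) (j : Fin n) :
    singVal A j = √(eig (isHermitian_conjTranspose_mul_self A) j) := by
  have h : Matrix.toEuclideanLin (Aᴴ * A) =
      (LinearMap.adjoint (Matrix.toEuclideanLin A)) ∘ₗ (Matrix.toEuclideanLin A) := by
    rw [← toEuclideanLin_conjTranspose_eq_adjoint]
    ext; simp [Matrix.toLpLin_apply]
  rw [singVal]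
  have := (Matrix.toEuclideanLin A).singularValues_fin
    (n := Fintype.card (Fin n)) finrank_euclideanSpace (Fin.cast (Fintype.card_fin n).symm j)
  refine this.trans ?_
  simp only [eig, IsHermitian.eigenvalues₀]
  congr 1
  congr 1
  simp only [h]

theorem eig_strictAnti_of_singVal_injective {n : ℕ} {A : Matrix (Fin n) (Fin n) ℂ}
    (hA : Function.Injective (singVal A)) :
    StrictAnti (eig (isHermitian_conjTranspose_mul_self A)) :=
  (eig_antitone _).strictAnti_of_injective fun i j hij =>
    hA (by rw [singVal_eq_sqrt_eig, singVal_eq_sqrt_eig, hij])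

/-- The derivative of ∏ (X - λ_k) at λ_j is the product of the gaps λ_j - λ_k. -/
theorem eval_derivative_charpoly_eig_ne_zero {n : ℕ} {H : Matrix (Fin n) (Fin n) ℂ}
    (hH : H.IsHermitian) (hs : Function.Injective (eig hH)) (j : Fin n) :
    H.charpoly.derivative.eval (eig hH j : ℂ) ≠ 0 := by
  rw [charpoly_eq_prod_eig hH, Lagrange.eval_nodal_derivative_eval_node_eq
      (v := fun j => (eig hH j : ℂ)) (Finset.mem_univ j), Lagrange.eval_nodal]
  refine Finset.prod_ne_zero_iff.2 fun k hk => ?_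
  rw [sub_ne_zero]
  intro h
  exact Finset.ne_of_mem_erase hk (hs (Complex.ofReal_injective h)).symm

/-! ### Local C¹ singular value decomposition. -/

section LocalSVD

variable {E : Type*} [NormedAddCommGroup E] [NormedSpace ℝ E] {n : ℕ}

theorem MatrixC1At.scalar_sub {A : E → Matrix (Fin n) (Fin n) ℂ} {x : E} {c : E → ℂ}
    (hc : ContDiffAt ℝ 1 c x) (hA : MatrixC1At A x) :
    MatrixC1At (fun y => scalar (Fin n) (c y) - A y) x :=
  (MatrixC1At.diagonal (d := fun y _ => c y) fun _ => hc).sub hA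

/-- A simple eigenvalue of a `C¹` Hermitian matrix function is locally `C¹`. -/
theorem exists_contDiffAt_eigenvalue [CompleteSpace E] {H : E → Matrix (Fin n) (Fin n) ℂ} {x : E}
    (hH : MatrixC1At H x) (hherm : ∀ y, (H y).IsHermitian)
    (hs : Function.Injective (eig (hherm x))) (j : Fin n) :
    ∃ φ : E → ℝ, ContDiffAt ℝ 1 φ x ∧ φ x = eig (hherm x) j ∧
      ∀ᶠ y in 𝓝 x, (H y).charpoly.eval (φ y : ℂ) = 0 := by
  -- For real t the determinant of t - H is real, so taking the real part loses nothing and the real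
  -- implicit function theorem applies.
  let f : E × ℝ → ℝ := fun p => (scalar (Fin n) (p.2 : ℂ) - H p.1).det.re
  have hf : ContDiffAt ℝ 1 f (x, eig (hherm x) j) := by
    have h1 : MatrixC1At (fun p : E × ℝ => scalar (Fin n) (p.2 : ℂ) - H p.1)
        (x, eig (hherm x) j) :=
      MatrixC1At.scalar_sub (contDiff_ofReal.contDiffAt.comp _ contDiffAt_snd)
        (hH.comp (f := Prod.fst) contDiffAt_fst)
    exact Complex.reCLM.contDiff.contDiffAt.comp _ h1.det
  have hroot : (H x).charpoly.eval (eig (hherm x) j : ℂ) = 0 := by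
    rw [charpoly_eq_prod_eig (hherm x)]
    exact Lagrange.eval_nodal_at_node (v := fun j => (eig (hherm x) j : ℂ)) (Finset.mem_univ j)
  have hd : HasDerivAt (fun t : ℝ => f (x, t))
      ((H x).charpoly.derivative.eval (eig (hherm x) j : ℂ)).re (eig (hherm x) j) := by
    have h1 := ((H x).charpoly.hasDerivAt (eig (hherm x) j : ℂ)).real_of_complex
    simpa only [f, eval_charpoly] using h1
  have him : ((H x).charpoly.derivative.eval (eig (hherm x) j : ℂ)).im = 0 := by
    rw [charpoly_eq_prod_eig (hherm x), Lagrange.eval_nodal_derivative_eval_node_eq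
      (v := fun j => (eig (hherm x) j : ℂ)) (Finset.mem_univ j), Lagrange.eval_nodal]
    rw [← Complex.ofReal_im (∏ k ∈ Finset.univ.erase j, (eig (hherm x) j - eig (hherm x) k))]
    push_cast
    rfl
  obtain ⟨φ, h1, h2, h3⟩ := exists_implicit_root hf
    (by simp only [f, ← eval_charpoly, hroot, Complex.zero_re]) hd
    (fun h => eval_derivative_charpoly_eig_ne_zero (hherm x) hs j (Complex.ext h him))
  refine ⟨φ, h1, h2, ?_⟩
  filter_upwards [h3] with y hy
  rw [eval_charpoly]
  refine Complex.ext hy (im_det_eq_zero_of_isHermitian ?_)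
  refine IsHermitian.sub ?_ (hherm y)
  simp [Matrix.IsHermitian, diagonal_conjTranspose, Pi.star_def]

/-- A simple eigenvalue of class `C¹` has a `C¹` unit eigenvector. -/
theorem exists_contDiffAt_eigenvector {H : E → Matrix (Fin n) (Fin n) ℂ} {x : E}
    (hH : MatrixC1At H x) {φ : E → ℝ} (hφ : ContDiffAt ℝ 1 φ x)
    (hroot : ∀ᶠ y in 𝓝 x, (H y).charpoly.eval (φ y : ℂ) = 0)
    (hsimple : (H x).charpoly.derivative.eval (φ x : ℂ) ≠ 0) :
    ∃ v : E → Fin n → ℂ, (∀ i, ContDiffAt ℝ 1 (fun y => v y i) x) ∧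
      ∀ᶠ y in 𝓝 x, H y *ᵥ v y = (φ y : ℂ) • v y ∧ star (v y) ⬝ᵥ v y = 1 := by
  have hadj := adjugate_ne_zero_of_simple_root (H x) (φ x) hroot.self_of_nhds hsimple
  obtain ⟨j, hj⟩ : ∃ j, (fun i => (scalar (Fin n) (φ x : ℂ) - H x).adjugate i j) ≠ 0 := by
    by_contra! h
    exact hadj (by ext i j; exact congrFun (h j) i)
  -- Every column of adj(φ - H) is annihilated by φ - H, because their product is det(φ - H) I = 0.
  -- A column that is nonzero at x stays nonzero nearby and can be normalized.
  let w : E → Fin n → ℂ := fun y i => (scalar (Fin n) (φ y : ℂ) - H y).adjugate i j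
  have hw : ∀ i, ContDiffAt ℝ 1 (fun y => w y i) x := fun i =>
    (MatrixC1At.scalar_sub (contDiff_ofReal.contDiffAt.comp x hφ) hH).adjugate i j
  let N : E → ℝ := fun y => ∑ i, Complex.normSq (w y i)
  have hN : ContDiffAt ℝ 1 N x :=
    ContDiffAt.sum fun i _ => contDiff_normSq.contDiffAt.comp x (hw i)
  have hNx : 0 < N x := by
    obtain ⟨i, hi⟩ := Function.ne_iff.1 hj
    exact Finset.sum_pos' (fun i _ => Complex.normSq_nonneg _)
      ⟨i, Finset.mem_univ i, Complex.normSq_pos.2 hi⟩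
  have hsq : ContDiffAt ℝ 1 (fun y => (((√(N y))⁻¹ : ℝ) : ℂ)) x :=
    contDiff_ofReal.contDiffAt.comp x ((hN.sqrt hNx.ne').inv (Real.sqrt_pos.2 hNx).ne')
  refine ⟨fun y => (((√(N y))⁻¹ : ℝ) : ℂ) • w y, fun i => hsq.mul (hw i), ?_⟩
  filter_upwards [hroot, hN.continuousAt.eventually (lt_mem_nhds hNx)] with y hy hNy
  have hev : H y *ᵥ w y = (φ y : ℂ) • w y := by
    have h1 := mul_adjugate (scalar (Fin n) (φ y : ℂ) - H y)
    rw [← eval_charpoly, hy, zero_smul] at h1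
    have h2 : (scalar (Fin n) (φ y : ℂ) - H y) *ᵥ w y = 0 := by
      ext i
      exact congrFun (congrFun h1 i) j
    rw [sub_mulVec, sub_eq_zero] at h2
    rw [← h2]
    ext i
    simp [mulVec_diagonal]
  constructor
  · rw [mulVec_smul, hev, smul_comm]
  · have h1 : star (w y) ⬝ᵥ w y = (N y : ℂ) := by
      simp only [dotProduct, N, Complex.ofReal_sum, Complex.normSq_eq_conj_mul_self]
      rfl
    rw [star_smul, smul_dotProduct, dotProduct_smul, h1]
    simp only [smul_eq_mul, Complex.star_def, Complex.conj_ofReal]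
    norm_cast
    have := Real.mul_self_sqrt hNy.le
    have h0 := (Real.sqrt_pos.2 hNy).ne'
    field_simp
    rw [sq, this]

/-- Unit eigenvectors of a Hermitian matrix for distinct real eigenvalues form a unitary matrix. -/
theorem unitary_of_eigenvectors {H : Matrix (Fin n) (Fin n) ℂ} (hH : H.IsHermitian)
    {φ : Fin n → ℝ} (hφ : Function.Injective φ) {v : Fin n → Fin n → ℂ}
    (hv : ∀ j, H *ᵥ v j = (φ j : ℂ) • v j) (h1 : ∀ j, star (v j) ⬝ᵥ v j = 1) :
    (Matrix.of fun i j => v j i)ᴴ * (Matrix.of fun i j => v j i) = 1 := by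
  ext i j
  have hent : ((Matrix.of fun i j => v j i)ᴴ * (Matrix.of fun i j => v j i)) i j
      = star (v i) ⬝ᵥ v j := rfl
  rw [hent]
  by_cases hij : i = j
  · subst hij
    rw [h1, one_apply_eq]
  · rw [one_apply_ne hij]
    -- `e1` and `e2` evaluate v_i* H v_j by letting H act to the right and to the left.
    have e1 : star (v i) ⬝ᵥ (H *ᵥ v j) = (φ j : ℂ) * (star (v i) ⬝ᵥ v j) := by
      rw [hv, dotProduct_smul, smul_eq_mul]
    have e2 : star (v i) ⬝ᵥ (H *ᵥ v j) = (φ i : ℂ) * (star (v i) ⬝ᵥ v j) := by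
      rw [dotProduct_mulVec, ← hH.eq, ← star_mulVec, hv, star_smul, smul_dotProduct]
      simp
    have e3 : ((φ j : ℂ) - φ i) * (star (v i) ⬝ᵥ v j) = 0 := by rw [sub_mul, ← e1, ← e2, sub_self]
    refine (mul_eq_zero.1 e3).resolve_left ?_
    rw [sub_eq_zero]
    exact fun h => hij (hφ (Complex.ofReal_injective h)).symm

/-- A singular value decomposition up to phases of the diagonal factor: `A = U diag(s) V*` with
`U`, `V` unitary and `|s₀| > |s₁| > ⋯`. -/
structure IsPhasedSVD (A U V : Matrix (Fin n) (Fin n) ℂ) (s : Fin n → ℂ) : Prop where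
  left : Uᴴ * U = 1
  right : Vᴴ * V = 1
  eq : A = U * diagonal s * Vᴴ
  strictAnti : StrictAnti fun j => Complex.normSq (s j)

/-- UᴴAV commutes with diag(φ), whose entries are distinct, so it is diagonal. Its entries have
squared modulus φ_j because (UᴴAV)ᴴ(UᴴAV) = VᴴAᴴAV = diag(φ). The phases depend on the independent
choices of u_j and v_j. -/
theorem isPhasedSVD_of_eigenvectors {A : Matrix (Fin n) (Fin n) ℂ} {φ : Fin n → ℝ}
    (hφ : StrictAnti φ) {u v : Fin n → Fin n → ℂ}
    (hu : ∀ j, (A * Aᴴ) *ᵥ u j = (φ j : ℂ) • u j) (hu1 : ∀ j, star (u j) ⬝ᵥ u j = 1)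
    (hv : ∀ j, (Aᴴ * A) *ᵥ v j = (φ j : ℂ) • v j) (hv1 : ∀ j, star (v j) ⬝ᵥ v j = 1) :
    IsPhasedSVD A (Matrix.of fun i j => u j i) (Matrix.of fun i j => v j i)
      (fun j => ((Matrix.of fun i j => u j i)ᴴ * A * (Matrix.of fun i j => v j i)) j j) := by
  have hU := unitary_of_eigenvectors (isHermitian_mul_conjTranspose_self A) hφ.injective hu hu1
  have hV := unitary_of_eigenvectors (isHermitian_conjTranspose_mul_self A) hφ.injective hv hv1
  set U : Matrix (Fin n) (Fin n) ℂ := Matrix.of fun i j => u j i with hUdef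
  set V : Matrix (Fin n) (Fin n) ℂ := Matrix.of fun i j => v j i with hVdef
  have hU' := mul_eq_one_comm.1 hU
  have hV' := mul_eq_one_comm.1 hV
  have hUe : A * Aᴴ * U = U * diagonal (fun j => (φ j : ℂ)) := by
    ext i j
    have := congrFun (hu j) i
    rw [mul_diagonal, mul_comm (U i j)]
    exact this
  have hVe : Aᴴ * A * V = V * diagonal (fun j => (φ j : ℂ)) := by
    ext i j
    have := congrFun (hv j) i
    rw [mul_diagonal, mul_comm (V i j)]
    exact this
  have hUe' : Uᴴ * (A * Aᴴ) = diagonal (fun j => (φ j : ℂ)) * Uᴴ := by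
    have := congrArg Matrix.conjTranspose hUe
    simpa [Matrix.mul_assoc, Function.comp_def, Pi.star_def] using this
  have hcomm : diagonal (fun j => (φ j : ℂ)) * (Uᴴ * A * V)
      = Uᴴ * A * V * diagonal (fun j => (φ j : ℂ)) := by
    calc _ = (diagonal (fun j => (φ j : ℂ)) * Uᴴ) * A * V := by simp only [Matrix.mul_assoc]
      _ = Uᴴ * A * (Aᴴ * A * V) := by rw [← hUe']; simp only [Matrix.mul_assoc]
      _ = _ := by rw [hVe]; simp only [Matrix.mul_assoc]
  have hdiag : Uᴴ * A * V = diagonal fun j => (Uᴴ * A * V) j j := by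
    ext i j
    by_cases hij : i = j
    · subst hij; simp
    · rw [diagonal_apply_ne _ hij]
      have := congrFun (congrFun hcomm i) j
      rw [diagonal_mul, mul_diagonal, mul_comm _ (φ j : ℂ), ← sub_eq_zero, ← sub_mul] at this
      refine (mul_eq_zero.1 this).resolve_left ?_
      rw [sub_eq_zero]
      exact fun h => hij (hφ.injective (Complex.ofReal_injective h))
  have hnorm : ∀ j, Complex.normSq ((Uᴴ * A * V) j j) = φ j := by
    intro j
    have h1 : (Uᴴ * A * V)ᴴ * (Uᴴ * A * V) = diagonal (fun j => (φ j : ℂ)) := by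
      calc _ = Vᴴ * Aᴴ * (U * Uᴴ) * A * V := by
            simp only [conjTranspose_mul, conjTranspose_conjTranspose, Matrix.mul_assoc]
        _ = Vᴴ * (Aᴴ * A * V) := by rw [hU']; simp only [Matrix.mul_assoc, Matrix.one_mul]
        _ = _ := by rw [hVe, ← Matrix.mul_assoc, hV, Matrix.one_mul]
    rw [hdiag, diagonal_conjTranspose, diagonal_mul_diagonal] at h1
    have h2 := congrFun (diagonal_injective h1) j
    simp only [Pi.star_apply, Complex.star_def, ← Complex.normSq_eq_conj_mul_self] at h2
    exact Complex.ofReal_injective h2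
  refine ⟨hU, hV, ?_, ?_⟩
  · rw [← hdiag]
    calc A = (U * Uᴴ) * A * (V * Vᴴ) := by rw [hU', hV', Matrix.one_mul, Matrix.mul_one]
      _ = _ := by simp only [Matrix.mul_assoc]
  · simpa only [hnorm] using hφ

/-- A `C¹` matrix function with distinct singular values has a local `C¹` singular value
decomposition up to phases. -/
theorem exists_local_phasedSVD [CompleteSpace E] {A : E → Matrix (Fin n) (Fin n) ℂ} {x : E}
    (hA : MatrixC1At A x) (hσ : Function.Injective (singVal (A x))) :
    ∃ (U V : E → Matrix (Fin n) (Fin n) ℂ) (s : E → Fin n → ℂ),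
      MatrixC1At U x ∧ MatrixC1At V x ∧ (∀ j, ContDiffAt ℝ 1 (fun y => s y j) x) ∧
      ∀ᶠ y in 𝓝 x, IsPhasedSVD (A y) (U y) (V y) (s y) := by
  have hs := eig_strictAnti_of_singVal_injective hσ
  have hH : MatrixC1At (fun y => (A y)ᴴ * A y) x := hA.conjTranspose.mul hA
  have hG : MatrixC1At (fun y => A y * (A y)ᴴ) x := hA.mul hA.conjTranspose
  choose φ hφ hφx hroot using exists_contDiffAt_eigenvalue hH
    (fun y => isHermitian_conjTranspose_mul_self (A y)) hs.injective
  have hsimple : ∀ j, ((A x)ᴴ * A x).charpoly.derivative.eval (φ j x : ℂ) ≠ 0 := by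
    intro j
    rw [hφx]
    exact eval_derivative_charpoly_eig_ne_zero _ hs.injective j
  choose v hvC hv using fun j => exists_contDiffAt_eigenvector hH (hφ j) (hroot j) (hsimple j)
  -- AAᴴ and AᴴA have the same characteristic polynomial, so the same functions φ_j serve for both.
  choose u huC hu using fun j => exists_contDiffAt_eigenvector hG (hφ j)
    (by simpa only [charpoly_mul_comm (A _) (A _)ᴴ] using hroot j)
    (by simpa only [charpoly_mul_comm (A _) (A _)ᴴ] using hsimple j)
  have hanti : ∀ᶠ y in 𝓝 x, StrictAnti fun j => φ j y := by
    simp only [StrictAnti, eventually_all]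
    intro i j hij
    refine (hφ j).continuousAt.eventually_lt (hφ i).continuousAt ?_
    rw [hφx, hφx]
    exact hs hij
  have hUC : MatrixC1At (fun y => Matrix.of fun i j => u j y i) x := fun i j => huC j i
  have hVC : MatrixC1At (fun y => Matrix.of fun i j => v j y i) x := fun i j => hvC j i
  refine ⟨_, _, _, hUC, hVC, fun j => ((hUC.conjTranspose.mul hA).mul hVC) j j, ?_⟩
  filter_upwards [eventually_all.2 hu, eventually_all.2 hv, hanti] with y hu hv ha
  exact isPhasedSVD_of_eigenvectors ha (fun j => (hu j).1) (fun j => (hu j).2)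
    (fun j => (hv j).1) (fun j => (hv j).2)

end LocalSVD

/-! ### Reading off ordered eigenvalues; rotations of the 2 × 2 blocks. -/

/-- A decreasing enumeration of the diagonal in a unitary diagonalization lists the eigenvalues. -/
theorem eig_eq_of_diagonalization {m : ℕ} {B : Matrix (Fin m) (Fin m) ℂ} (hB : B.IsHermitian)
    {T : Matrix (Fin m) (Fin m) ℂ} (hT : Tᴴ * T = 1) {d : Fin m → ℝ} (hd : Antitone d)
    (h : B = T * diagonal (fun i => (d i : ℂ)) * Tᴴ) : eig hB = d := by
  have hc : B.charpoly = ∏ i, (Polynomial.X - Polynomial.C (d i : ℂ)) := by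
    rw [h, charpoly_mul_comm, ← Matrix.mul_assoc, hT, Matrix.one_mul, charpoly_diagonal]
  have hr : B.charpoly.roots = Multiset.map (fun i => (d i : ℂ)) Finset.univ.val := by
    rw [hc, Polynomial.roots_prod _ _ (Finset.prod_ne_zero_iff.2
      fun i _ => Polynomial.X_sub_C_ne_zero _)]
    simp
  have hs := hB.sort_roots_charpoly_eq_eigenvalues₀
  have hs2 : (B.charpoly.roots.map RCLike.re).sort (· ≥ ·) = List.ofFn d := by
    rw [hr, Fin.univ_val_map, Multiset.map_coe, List.map_ofFn, Multiset.coe_sort]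
    have : (RCLike.re : ℂ → ℝ) ∘ (fun i => (d i : ℂ)) = d := by
      ext i; simp
    rw [this]
    apply List.mergeSort_of_pairwise
    simp_rw [decide_eq_true_eq, ← List.sortedGE_iff_pairwise]
    exact hd.sortedGE_ofFn
  have hs3 : List.ofFn (eig hB) = List.ofFn d := by
    rw [← hs2, hs]
    refine List.ext_getElem (by simp) fun i h1 h2 => ?_
    simp [eig]
  exact List.ofFn_injective hs3

theorem mul_conjTranspose_eq_one_of_equiv {ι κ : Type*} [Fintype ι] [Fintype κ] [DecidableEq ι]
    [DecidableEq κ] (e : ι ≃ κ) {T : Matrix ι κ ℂ} (h : Tᴴ * T = 1) : T * Tᴴ = 1 :=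
  (Matrix.mul_eq_one_comm_of_equiv e.symm).1 h

section Rotation

variable {n : ℕ}

/-- `[[ε, z], [z̄, -ε]]` is conjugate to `[[a, b], [b̄, -a]]` by the unitary matrix
`[[p, -q], [q̄, p]]`. -/
structure IsRotation (ε : ℝ) (z : ℂ) (p : ℝ) (q : ℂ) (a : ℝ) (b : ℂ) : Prop where
  norm : (p : ℂ) * p + q * star q = 1
  diag : (ε : ℂ) * p + z * star q = p * a - q * star b
  offDiag : z * p - ε * q = p * b + q * a

theorem isRotation_refl (ε : ℝ) (z : ℂ) : IsRotation ε z 1 0 ε z :=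
  ⟨by simp, by simp, by simp⟩

/-- The positive eigenvalue of `[[ε, z], [z̄, -ε]]`. -/
def posEig (ε : ℝ) (z : ℂ) : ℝ := √(ε ^ 2 + Complex.normSq z)

theorem posEig_nonneg (ε : ℝ) (z : ℂ) : 0 ≤ posEig ε z := Real.sqrt_nonneg _

theorem posEig_sq (ε : ℝ) (z : ℂ) : posEig ε z ^ 2 = ε ^ 2 + Complex.normSq z :=
  Real.sq_sqrt (add_nonneg (sq_nonneg _) (Complex.normSq_nonneg _))

theorem posEig_pos (ε : ℝ) {z : ℂ} (hz : z ≠ 0) : 0 < posEig ε z :=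
  Real.sqrt_pos.2 (add_pos_of_nonneg_of_pos (sq_nonneg _) (Complex.normSq_pos.2 hz))

/-- The length of the eigenvector `(ε + λ, z̄)` of `[[ε, z], [z̄, -ε]]`. -/
def rotNorm (ε : ℝ) (z : ℂ) : ℝ := √((ε + posEig ε z) ^ 2 + Complex.normSq z)

theorem rotNorm_pos (ε : ℝ) {z : ℂ} (hz : z ≠ 0) : 0 < rotNorm ε z :=
  Real.sqrt_pos.2 (add_pos_of_nonneg_of_pos (sq_nonneg _) (Complex.normSq_pos.2 hz))

theorem rotNorm_sq (ε : ℝ) (z : ℂ) :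
    rotNorm ε z ^ 2 = (ε + posEig ε z) ^ 2 + Complex.normSq z :=
  Real.sq_sqrt (add_nonneg (sq_nonneg _) (Complex.normSq_nonneg _))

/-- The first column is the normalized eigenvector (ε + λ, z̄) for λ = `posEig ε z`. The condition z
≠ 0 keeps the normalizing factor positive, which also makes these formulas C¹ there. -/
theorem isRotation_of_ne_zero (ε : ℝ) {z : ℂ} (hz : z ≠ 0) :
    IsRotation ε z ((ε + posEig ε z) / rotNorm ε z) (z / (rotNorm ε z : ℝ)) (posEig ε z) 0 := by
  have hN : (rotNorm ε z : ℂ) ≠ 0 := by exact_mod_cast (rotNorm_pos ε hz).ne'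
  have hz2 : z * star z = (Complex.normSq z : ℂ) := Complex.mul_conj z
  have h1 : (posEig ε z : ℂ) ^ 2 = (ε : ℂ) ^ 2 + Complex.normSq z := by
    exact_mod_cast posEig_sq ε z
  have h2 : (rotNorm ε z : ℂ) ^ 2 = ((ε : ℂ) + posEig ε z) ^ 2 + Complex.normSq z := by
    exact_mod_cast rotNorm_sq ε z
  have hs : star (z / (rotNorm ε z : ℂ)) = star z / (rotNorm ε z : ℂ) := by
    simp
  constructor
  · rw [hs]
    push_cast
    field_simp
    rw [hz2, h2]
  · rw [hs]
    push_cast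
    field_simp
    rw [hz2]
    simp only [star_zero]
    linear_combination -h1
  · push_cast
    field_simp
    ring

/-- A pointwise statement without continuity, enough for computing eigenvalues. For z = 0 and ε ≤ 0
the eigenvector formula degenerates and the coordinates are swapped instead. -/
theorem exists_isRotation (ε : ℝ) (z : ℂ) : ∃ p q, IsRotation ε z p q (posEig ε z) 0 := by
  by_cases hz : z = 0
  · subst hz
    rcases le_total 0 ε with h | h
    · refine ⟨1, 0, ?_⟩
      have : posEig ε 0 = ε := by simp [posEig, Real.sqrt_sq h]
      rw [this]
      exact isRotation_refl ε 0
    · refine ⟨0, 1, ?_⟩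
      have : posEig ε 0 = -ε := by simp [posEig, Real.sqrt_sq_eq_abs, abs_of_nonpos h]
      rw [this]
      exact ⟨by simp, by simp, by simp⟩
  · exact ⟨_, _, isRotation_of_ne_zero ε hz⟩

/-- The Hermitian block matrix `[[diag a, diag b], [diag b̄, -diag a]]`. -/
def diagBlocks (a : Fin n → ℝ) (b : Fin n → ℂ) : Matrix (Fin n ⊕ Fin n) (Fin n ⊕ Fin n) ℂ :=
  fromBlocks (diagonal fun j => (a j : ℂ)) (diagonal b) (diagonal fun j => star (b j))
    (diagonal fun j => -(a j : ℂ))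

/-- The block rotation `[[diag p, -diag q], [diag q̄, diag p]]`. -/
def rotBlocks (p : Fin n → ℝ) (q : Fin n → ℂ) : Matrix (Fin n ⊕ Fin n) (Fin n ⊕ Fin n) ℂ :=
  fromBlocks (diagonal fun j => (p j : ℂ)) (diagonal fun j => -q j)
    (diagonal fun j => star (q j)) (diagonal fun j => (p j : ℂ))

variable {ε : ℝ} {s : Fin n → ℂ} {p : Fin n → ℝ} {q : Fin n → ℂ} {a : Fin n → ℝ} {b : Fin n → ℂ}

theorem rotBlocks_unitary (h : ∀ j, IsRotation ε (s j) (p j) (q j) (a j) (b j)) :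
    (rotBlocks p q)ᴴ * rotBlocks p q = 1 := by
  have hp : ∀ j, (p j : ℂ) * p j + q j * star (q j) = 1 := fun j => (h j).norm
  rw [rotBlocks, fromBlocks_conjTranspose, fromBlocks_multiply, ← fromBlocks_one]
  simp only [diagonal_conjTranspose, diagonal_mul_diagonal, diagonal_add]
  congr 1
  · rw [← diagonal_one]; congr 1; ext j; simpa using hp j
  · rw [← diagonal_zero]; congr 1; ext j; simp [mul_comm]
  · rw [← diagonal_zero]; congr 1; ext j; simp [mul_comm]
  · rw [← diagonal_one]; congr 1; ext j
    have := hp j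
    simp only [Pi.star_apply, star_neg, Complex.star_def, Complex.conj_ofReal] at this ⊢
    linear_combination this

/-- The lower two block identities are conjugates of the upper two, up to sign, so `IsRotation` need
only record the first row. -/
theorem diagBlocks_mul_rotBlocks (h : ∀ j, IsRotation ε (s j) (p j) (q j) (a j) (b j)) :
    diagBlocks (fun _ => ε) s * rotBlocks p q = rotBlocks p q * diagBlocks a b := by
  rw [rotBlocks, diagBlocks, diagBlocks, fromBlocks_multiply, fromBlocks_multiply]
  simp only [diagonal_mul_diagonal, diagonal_add]
  congr 2 <;> ext j
  · linear_combination (h j).diag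
  · linear_combination (h j).offDiag
  · have := congrArg star (h j).offDiag
    simp only [star_add, star_sub, star_mul', Complex.star_def, Complex.conj_ofReal] at this ⊢
    linear_combination this
  · have := congrArg star (h j).diag
    simp only [star_add, star_sub, star_mul', Complex.star_def, Complex.conj_ofReal,
      Complex.conj_conj] at this ⊢
    linear_combination -this

/-- The unitary factor of the decomposition of `M` built from an SVD and rotations. -/
def frame (U V : Matrix (Fin n) (Fin n) ℂ) (p : Fin n → ℝ) (q : Fin n → ℂ) :
    Matrix (Fin (n + n)) (Fin n ⊕ Fin n) ℂ :=
  (fromBlocks U 0 0 V * rotBlocks p q).submatrix finSumFinEquiv.symm id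

variable {A : Plane → Matrix (Fin n) (Fin n) ℂ} {ξ : Plane} {U V : Matrix (Fin n) (Fin n) ℂ}

theorem frame_unitary (hA : IsPhasedSVD (A ξ) U V s)
    (h : ∀ j, IsRotation ε (s j) (p j) (q j) (a j) (b j)) :
    (frame U V p q)ᴴ * frame U V p q = 1 := by
  have h1 : (fromBlocks U 0 0 V)ᴴ * fromBlocks U 0 0 V = 1 := by
    rw [fromBlocks_conjTranspose, fromBlocks_multiply, ← fromBlocks_one]
    simp [hA.left, hA.right]
  rw [frame, conjTranspose_submatrix, submatrix_mul_equiv, submatrix_id_id, conjTranspose_mul,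
    Matrix.mul_assoc, ← Matrix.mul_assoc (fromBlocks U 0 0 V)ᴴ, h1, Matrix.one_mul,
    rotBlocks_unitary h]

/-- Conjugation by diag(U, V) preserves ±εI and turns A into diag(s); the rotations then act on each
index j separately. -/
theorem hermitianM_eq_frame (hA : IsPhasedSVD (A ξ) U V s)
    (h : ∀ j, IsRotation ε (s j) (p j) (q j) (a j) (b j)) :
    hermitianM A (ξ, ε) = frame U V p q * diagBlocks a b * (frame U V p q)ᴴ := by
  have hU := mul_eq_one_comm.1 hA.left
  have hV := mul_eq_one_comm.1 hA.right
  have hQ := mul_eq_one_comm.1 (rotBlocks_unitary h)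
  have hK : rotBlocks p q * diagBlocks a b * (rotBlocks p q)ᴴ = diagBlocks (fun _ => ε) s := by
    rw [← diagBlocks_mul_rotBlocks h, Matrix.mul_assoc, hQ, Matrix.mul_one]
  have hM : fromBlocks ((ε : ℂ) • (1 : Matrix (Fin n) (Fin n) ℂ)) (A ξ) (A ξ)ᴴ
      (-((ε : ℂ) • (1 : Matrix (Fin n) (Fin n) ℂ)))
      = fromBlocks U 0 0 V * diagBlocks (fun _ => ε) s * (fromBlocks U 0 0 V)ᴴ := by
    have hd : (diagonal fun _ : Fin n => (ε : ℂ)) = (ε : ℂ) • 1 := by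
      rw [smul_one_eq_diagonal]
    have hd' : (diagonal fun _ : Fin n => -(ε : ℂ)) = -((ε : ℂ) • 1) := by
      rw [smul_one_eq_diagonal, diagonal_neg]
    rw [diagBlocks, fromBlocks_conjTranspose, fromBlocks_multiply, fromBlocks_multiply, hd, hd']
    simp [hU, hV, hA.eq, diagonal_conjTranspose, Matrix.mul_assoc, Pi.star_def]
  have hX : fromBlocks U 0 0 V * diagBlocks (fun _ => ε) s * (fromBlocks U 0 0 V)ᴴ
      = (fromBlocks U 0 0 V * rotBlocks p q) * diagBlocks a b *
        (fromBlocks U 0 0 V * rotBlocks p q)ᴴ := by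
    simp only [← hK, conjTranspose_mul, Matrix.mul_assoc]
  rw [hermitianM, reindex_apply, hM, hX]
  rfl

end Rotation

/-! ### Spectrum of M and the place of coalescence. -/

/-- The enumeration of `± λ_j` in decreasing order. -/
def ordEquiv (n : ℕ) : Fin (n + n) ≃ Fin n ⊕ Fin n :=
  -- The second copy is reversed because -λ_j increases with j.
  finSumFinEquiv.symm.trans (Equiv.sumCongr (Equiv.refl _) Fin.revPerm)

theorem ordEquiv_of_lt {n : ℕ} (i : Fin (n + n)) (h : (i : ℕ) < n) :
    ordEquiv n i = Sum.inl ⟨i, h⟩ := by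
  have : i = Fin.castAdd n ⟨i, h⟩ := rfl
  exact (congrArg (ordEquiv n) this).trans (by
    simp only [ordEquiv, Equiv.trans_apply, finSumFinEquiv_symm_apply_castAdd,
      Equiv.sumCongr_apply, Sum.map_inl, Equiv.refl_apply])

theorem ordEquiv_of_ge {n : ℕ} (i : Fin (n + n)) (h : n ≤ (i : ℕ)) :
    ordEquiv n i = Sum.inr ⟨n + n - 1 - i, by omega⟩ := by
  have : i = Fin.natAdd n ⟨i - n, by omega⟩ := by ext; simp; omega
  refine (congrArg (ordEquiv n) this).trans ?_
  simp only [ordEquiv, Equiv.trans_apply, finSumFinEquiv_symm_apply_natAdd,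
    Equiv.sumCongr_apply, Sum.map_inr, Fin.revPerm_apply]
  congr 1
  ext
  simp [Fin.val_rev]
  omega

/-- `λ_j` on the first summand and `-λ_j` on the second one. -/
def signedEig {n : ℕ} (ε : ℝ) (s : Fin n → ℂ) : Fin n ⊕ Fin n → ℝ :=
  Sum.elim (fun j => posEig ε (s j)) (fun j => -posEig ε (s j))

theorem posEig_lt_posEig {ε : ℝ} {z w : ℂ} (h : Complex.normSq z < Complex.normSq w) :
    posEig ε z < posEig ε w :=
  Real.sqrt_lt_sqrt (add_nonneg (sq_nonneg _) (Complex.normSq_nonneg _)) (by linarith)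

theorem posEig_strictAnti {n : ℕ} (ε : ℝ) {s : Fin n → ℂ}
    (hs : StrictAnti fun j => Complex.normSq (s j)) : StrictAnti fun j => posEig ε (s j) :=
  fun _ _ hij => posEig_lt_posEig (hs hij)

theorem signedEig_antitone {n : ℕ} (ε : ℝ) {s : Fin n → ℂ}
    (hs : StrictAnti fun j => Complex.normSq (s j)) :
    Antitone fun i => signedEig ε s (ordEquiv n i) := by
  have hl := (posEig_strictAnti ε hs).antitone
  intro i j hij
  have hij' : (i : ℕ) ≤ j := hij
  rcases lt_or_ge (i : ℕ) n with hi | hi <;> rcases lt_or_ge (j : ℕ) n with hj | hj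
  · simp only [ordEquiv_of_lt _ hi, ordEquiv_of_lt _ hj, signedEig, Sum.elim_inl]
    exact hl (by simpa using hij')
  · simp only [ordEquiv_of_lt _ hi, ordEquiv_of_ge _ hj, signedEig, Sum.elim_inl, Sum.elim_inr]
    linarith [posEig_nonneg ε (s ⟨i, hi⟩), posEig_nonneg ε (s ⟨n + n - 1 - j, by omega⟩)]
  · omega
  · simp only [ordEquiv_of_ge _ hi, ordEquiv_of_ge _ hj, signedEig, Sum.elim_inr]
    exact neg_le_neg (hl (by simp only [Fin.mk_le_mk]; omega))

/-- The eigenvalues of `M(ξ, ε)` are `± √(ε² + σ_j(A(ξ))²)`. -/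
theorem eig_hermitianM {n : ℕ} {A : Plane → Matrix (Fin n) (Fin n) ℂ} {ξ : Plane} {ε : ℝ}
    {U V : Matrix (Fin n) (Fin n) ℂ} {s : Fin n → ℂ} (hA : IsPhasedSVD (A ξ) U V s)
    (i : Fin (n + n)) :
    eig (hermitianM_isHermitian A (ξ, ε)) i = signedEig ε s (ordEquiv n i) := by
  choose p q h using fun j => exists_isRotation ε (s j)
  have hT := frame_unitary hA h
  have hM := hermitianM_eq_frame hA h
  have hD : diagBlocks (fun j => posEig ε (s j)) (fun _ : Fin n => (0 : ℂ))
      = diagonal fun x => (signedEig ε s x : ℂ) := by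
    rw [diagBlocks]
    ext (x | x) (y | y) <;> simp [signedEig, diagonal_apply]
  rw [hD] at hM
  refine congrFun (eig_eq_of_diagonalization (hermitianM_isHermitian A (ξ, ε))
    (T := (frame U V p q).submatrix id (ordEquiv n)) ?_ (signedEig_antitone ε hA.strictAnti) ?_) i
  · rw [conjTranspose_submatrix, ← submatrix_mul _ _ _ _ _ Function.bijective_id, hT,
      submatrix_one_equiv]
  · rw [hM, conjTranspose_submatrix]
    have : (diagonal fun i => (signedEig ε s (ordEquiv n i) : ℂ))
        = (diagonal fun x => (signedEig ε s x : ℂ)).submatrix (ordEquiv n) (ordEquiv n) := by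
      rw [submatrix_diagonal_equiv]; rfl
    rw [this, submatrix_mul_equiv, submatrix_mul_equiv, submatrix_id_id]

/-- The rank is the number of nonzero s_i, and since the moduli decrease, the last one vanishes if
any does. -/
theorem IsPhasedSVD.rank_lt_iff {k : ℕ} {A U V : Matrix (Fin (k + 1)) (Fin (k + 1)) ℂ}
    {s : Fin (k + 1) → ℂ} (h : IsPhasedSVD A U V s) : A.rank < k + 1 ↔ s (Fin.last k) = 0 := by
  have hU : IsUnit U.det := isUnit_det_of_left_inverse h.left
  have hV : IsUnit (Vᴴ).det := isUnit_det_of_right_inverse h.right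
  have hr : A.rank = Fintype.card {i // s i ≠ 0} := by
    rw [h.eq, rank_mul_eq_left_of_isUnit_det _ _ hV, rank_mul_eq_right_of_isUnit_det _ _ hU,
      rank_diagonal]
  have hc : Fintype.card (Fin (k + 1)) = k + 1 := Fintype.card_fin _
  rw [hr]
  constructor
  · intro hlt
    by_contra hs
    have hall : ∀ i, s i ≠ 0 := by
      intro i hi
      have h1 := h.strictAnti.antitone (Fin.le_last i)
      simp only [hi, map_zero] at h1
      exact (Complex.normSq_pos.2 hs).not_ge h1
    rw [Fintype.card_of_subtype Finset.univ (by simpa using hall)] at hlt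
    simp at hlt
  · intro hs
    have := Fintype.card_subtype_lt (p := fun i => s i ≠ 0) (x := Fin.last k) (by simpa using hs)
    omega

theorem posEig_eq_zero_iff {ε : ℝ} {z : ℂ} : posEig ε z = 0 ↔ ε = 0 ∧ z = 0 := by
  have h1 := posEig_sq ε z
  have h2 := Complex.normSq_nonneg z
  constructor
  · intro h
    rw [h] at h1
    refine ⟨?_, Complex.normSq_eq_zero.1 ?_⟩
    · nlinarith
    · nlinarith [sq_nonneg ε]
  · rintro ⟨rfl, rfl⟩
    simp [posEig]

/-- Consecutive eigenvalues of `M` coalesce only in the middle, where `A` loses rank and `ε = 0`. -/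
theorem coalesceOnlyAt_hermitianM {k : ℕ} {Ω : Set Plane}
    {A : Plane → Matrix (Fin (k + 1)) (Fin (k + 1)) ℂ}
    (hA : ∀ ξ ∈ Ω, ∃ U V s, IsPhasedSVD (A ξ) U V s) {ξ₀ : Plane}
    (hrank : ∀ ξ ∈ Ω, (A ξ).rank < k + 1 ↔ ξ = ξ₀) :
    CoalesceOnlyAt (Ω ×ˢ (Set.univ : Set ℝ)) (hermitianM A)
      (fun η _ => hermitianM_isHermitian A η) k (ξ₀, 0) := by
  rintro j hj ⟨ξ, ε⟩ ⟨hξ, -⟩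
  obtain ⟨U, V, s, h⟩ := hA ξ hξ
  have hl := posEig_strictAnti ε h.strictAnti
  simp only [eig_hermitianM h]
  -- Off the middle, two neighbours carry the same sign and differ by strict monotonicity. The
  -- middle pair is λ, -λ for the smallest λ, equal only if λ = 0.
  rcases lt_trichotomy j k with hjk | rfl | hjk
  · rw [ordEquiv_of_lt _ (show j < k + 1 by omega), ordEquiv_of_lt _ (show j + 1 < k + 1 by omega)]
    simp only [signedEig, Sum.elim_inl]
    refine iff_of_false (hl ?_).ne' (fun h => hjk.ne h.1)
    simp
  · rw [ordEquiv_of_lt _ (show j < j + 1 by omega), ordEquiv_of_ge _ (show j + 1 ≤ j + 1 by omega)]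
    have e1 : (⟨j + 1 + (j + 1) - 1 - (j + 1), by omega⟩ : Fin (j + 1)) = Fin.last j := by
      ext; simp
    have e2 : (⟨j, by omega⟩ : Fin (j + 1)) = Fin.last j := rfl
    simp only [signedEig, Sum.elim_inl, Sum.elim_inr, e1, e2, true_and, Prod.mk.injEq]
    rw [self_eq_neg, posEig_eq_zero_iff, ← h.rank_lt_iff, hrank ξ hξ, and_comm]
  · rw [ordEquiv_of_ge _ (show k + 1 ≤ j by omega), ordEquiv_of_ge _ (show k + 1 ≤ j + 1 by omega)]
    simp only [signedEig, Sum.elim_inr, neg_inj]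
    refine iff_of_false (hl ?_).ne (fun h => hjk.ne' h.1)
    simp only [Fin.mk_lt_mk]
    omega

/-! ### The explicit block Schur decomposition of M. -/

/-- The column indices of a block Schur decomposition with the middle pair of eigenvalues first. -/
def middleEquiv (k : ℕ) :
    Fin 2 ⊕ {i : Fin (k + 1 + (k + 1)) // (i : ℕ) ≠ k ∧ (i : ℕ) ≠ k + 1} ≃
      Fin (k + 1 + (k + 1)) :=
  Equiv.ofBijective (Sum.elim ![⟨k, by omega⟩, ⟨k + 1, by omega⟩] Subtype.val) <| by
    constructor
    · rintro (a | a) (b | b) hab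
      · fin_cases a <;> fin_cases b <;> simp_all
      · exfalso
        have := b.2
        fin_cases a <;> simp only [Sum.elim_inl, Sum.elim_inr] at hab <;> rw [← hab] at this <;>
          simp at this
      · exfalso
        have := a.2
        fin_cases b <;> simp only [Sum.elim_inl, Sum.elim_inr] at hab <;> rw [hab] at this <;>
          simp at this
      · exact congrArg Sum.inr (Subtype.ext hab)
    · intro i
      by_cases h1 : (i : ℕ) = k
      · exact ⟨Sum.inl 0, Fin.ext h1.symm⟩
      · by_cases h2 : (i : ℕ) = k + 1
        · exact ⟨Sum.inl 1, Fin.ext h2.symm⟩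
        · exact ⟨Sum.inr ⟨i, h1, h2⟩, rfl⟩

/-- The position of the columns of a block Schur decomposition of `M` among `± λ_j`. -/
def blockEquiv (k : ℕ) :
    Fin 2 ⊕ {i : Fin (k + 1 + (k + 1)) // (i : ℕ) ≠ k ∧ (i : ℕ) ≠ k + 1} ≃
      Fin (k + 1) ⊕ Fin (k + 1) :=
  (middleEquiv k).trans (ordEquiv (k + 1))

theorem blockEquiv_inl_zero (k : ℕ) : blockEquiv k (Sum.inl 0) = Sum.inl (Fin.last k) :=
  ordEquiv_of_lt _ (show k < k + 1 by omega)

theorem blockEquiv_inl_one (k : ℕ) : blockEquiv k (Sum.inl 1) = Sum.inr (Fin.last k) := by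
  refine (ordEquiv_of_ge _ (show k + 1 ≤ k + 1 by omega)).trans (congrArg Sum.inr ?_)
  ext
  change k + 1 + (k + 1) - 1 - (k + 1) = k
  omega

theorem blockEquiv_inr {k : ℕ}
    (i : {i : Fin (k + 1 + (k + 1)) // (i : ℕ) ≠ k ∧ (i : ℕ) ≠ k + 1}) :
    blockEquiv k (Sum.inr i) = ordEquiv (k + 1) i :=
  rfl

/-- Dropping positions k and k + 1 drops the last index with both signs. The remaining s_x are
nonzero, which yields smoothness of `L` and nonvanishing of the other eigenvalues. -/
theorem blockEquiv_inr_ne_last {k : ℕ}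
    (i : {i : Fin (k + 1 + (k + 1)) // (i : ℕ) ≠ k ∧ (i : ℕ) ≠ k + 1}) :
    ∃ x, x ≠ Fin.last k ∧
      (ordEquiv (k + 1) i = Sum.inl x ∨ ordEquiv (k + 1) i = Sum.inr x) := by
  obtain ⟨i, h1, h2⟩ := i
  rcases lt_or_ge (i : ℕ) (k + 1) with hi | hi
  · exact ⟨_, fun h => h1 (congrArg Fin.val h), Or.inl (ordEquiv_of_lt i hi)⟩
  · refine ⟨_, fun h => ?_, Or.inr (ordEquiv_of_ge i hi)⟩
    have := congrArg Fin.val h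
    simp at this
    omega

section Construction

variable {k : ℕ}

/-- The diagonal rotation data diagonalizing all `2 × 2` blocks but the last one. -/
def rotP (ε : ℝ) (s : Fin (k + 1) → ℂ) (j : Fin (k + 1)) : ℝ :=
  if j = Fin.last k then 1 else (ε + posEig ε (s j)) / rotNorm ε (s j)

/-- The off-diagonal rotation data matching `rotP`. -/
def rotQ (ε : ℝ) (s : Fin (k + 1) → ℂ) (j : Fin (k + 1)) : ℂ :=
  if j = Fin.last k then 0 else s j / (rotNorm ε (s j) : ℝ)

/-- The diagonal entries left after the rotations `rotP`, `rotQ`. -/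
def rotA (ε : ℝ) (s : Fin (k + 1) → ℂ) (j : Fin (k + 1)) : ℝ :=
  if j = Fin.last k then ε else posEig ε (s j)

/-- The off-diagonal entries left after the rotations `rotP`, `rotQ`. -/
def rotB (s : Fin (k + 1) → ℂ) (j : Fin (k + 1)) : ℂ :=
  if j = Fin.last k then s j else 0

theorem IsPhasedSVD.ne_zero {A U V : Matrix (Fin (k + 1)) (Fin (k + 1)) ℂ}
    {s : Fin (k + 1) → ℂ} (h : IsPhasedSVD A U V s) {j : Fin (k + 1)} (hj : j ≠ Fin.last k) :
    s j ≠ 0 :=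
  Complex.normSq_pos.1 ((Complex.normSq_nonneg _).trans_lt
    (h.strictAnti (lt_of_le_of_ne (Fin.le_last j) hj)))

theorem IsPhasedSVD.isRotation {A U V : Matrix (Fin (k + 1)) (Fin (k + 1)) ℂ}
    {s : Fin (k + 1) → ℂ} (h : IsPhasedSVD A U V s) (ε : ℝ) (j : Fin (k + 1)) :
    IsRotation ε (s j) (rotP ε s j) (rotQ ε s j) (rotA ε s j) (rotB s j) := by
  by_cases hj : j = Fin.last k
  · simpa [rotP, rotQ, rotA, rotB, hj] using isRotation_refl ε (s (Fin.last k))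
  · simpa only [rotP, rotQ, rotA, rotB, if_neg hj] using isRotation_of_ne_zero ε (h.ne_zero hj)

/-- The `2 × 2` block `[[ε, z], [z̄, -ε]]`. -/
def middleBlock (ε : ℝ) (z : ℂ) : Matrix (Fin 2) (Fin 2) ℂ :=
  !![(ε : ℂ), z; star z, -(ε : ℂ)]

/-- Only the last index was left unrotated; `blockEquiv` moves its two coordinates to the front, and
the rest is already diagonal. -/
theorem diagBlocks_submatrix (ε : ℝ) (s : Fin (k + 1) → ℂ) :
    (diagBlocks (rotA ε s) (rotB s)).submatrix (blockEquiv k) (blockEquiv k)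
      = fromBlocks (middleBlock ε (s (Fin.last k))) 0 0
        (diagonal fun i => (signedEig ε s (ordEquiv (k + 1) i.1) : ℂ)) := by
  ext i j
  rw [submatrix_apply]
  rcases i with i | i <;> rcases j with j | j
  · fin_cases i <;> fin_cases j <;>
      simp [blockEquiv_inl_zero, blockEquiv_inl_one, diagBlocks, rotA, rotB, middleBlock]
  · obtain ⟨y, hy, hj | hj⟩ := blockEquiv_inr_ne_last j <;> fin_cases i <;>
      simp [blockEquiv_inl_zero, blockEquiv_inl_one, blockEquiv_inr, hj, diagBlocks,
        diagonal_apply_ne' _ hy]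
  · obtain ⟨y, hy, hi | hi⟩ := blockEquiv_inr_ne_last i <;> fin_cases j <;>
      simp [blockEquiv_inl_zero, blockEquiv_inl_one, blockEquiv_inr, hi, diagBlocks,
        diagonal_apply_ne _ hy]
  · rw [blockEquiv_inr, blockEquiv_inr, fromBlocks_apply₂₂]
    by_cases hij : i = j
    · subst hij
      obtain ⟨x, hx, hi | hi⟩ := blockEquiv_inr_ne_last i <;>
        simp [hi, diagBlocks, rotA, hx, signedEig]
    · rw [diagonal_apply_ne _ hij]
      have hne : ordEquiv (k + 1) i ≠ ordEquiv (k + 1) j :=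
        fun h => hij (Subtype.ext ((ordEquiv (k + 1)).injective h))
      obtain ⟨x, hx, hi | hi⟩ := blockEquiv_inr_ne_last i <;>
        obtain ⟨y, hy, hj | hj⟩ := blockEquiv_inr_ne_last j <;> rw [hi, hj] at hne ⊢
      · rw [diagBlocks, fromBlocks_apply₁₁]
        exact diagonal_apply_ne _ fun h => hne (congrArg _ h)
      · simp [diagBlocks, diagonal_apply, rotB, hx]
      · simp [diagBlocks, diagonal_apply, rotB, hx]
      · rw [diagBlocks, fromBlocks_apply₂₂]
        exact diagonal_apply_ne _ fun h => hne (congrArg _ h)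

theorem roots_charpoly_middleBlock (ε : ℝ) (z : ℂ) :
    (middleBlock ε z).charpoly.roots = {(posEig ε z : ℂ), ((-posEig ε z : ℝ) : ℂ)} := by
  have h1 : (posEig ε z : ℂ) ^ 2 = (ε : ℂ) ^ 2 + Complex.normSq z := by
    exact_mod_cast posEig_sq ε z
  have hz2 : z * star z = (Complex.normSq z : ℂ) := Complex.mul_conj z
  have h2 : (middleBlock ε z).charpoly = (Polynomial.X - Polynomial.C (posEig ε z : ℂ)) *
      (Polynomial.X - Polynomial.C ((-posEig ε z : ℝ) : ℂ)) := by
    have hdet : (middleBlock ε z).det = -(posEig ε z : ℂ) ^ 2 := by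
      rw [middleBlock, det_fin_two_of, hz2, h1]; ring
    have htr : (middleBlock ε z).trace = 0 := by simp [middleBlock, trace_fin_two_of]
    rw [charpoly_fin_two, hdet, htr]
    simp only [Complex.ofReal_neg, map_neg, map_pow, map_zero]
    ring
  rw [h2, Polynomial.roots_mul (mul_ne_zero (Polynomial.X_sub_C_ne_zero _)
    (Polynomial.X_sub_C_ne_zero _)), Polynomial.roots_X_sub_C, Polynomial.roots_X_sub_C]
  rfl

variable {E : Type*} [NormedAddCommGroup E] [NormedSpace ℝ E]

/-- z ≠ 0 keeps the radicand away from the singularity of the square root. -/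
theorem ContDiffAt.posEig {e : E → ℝ} {z : E → ℂ} {x : E} (he : ContDiffAt ℝ 1 e x)
    (hz : ContDiffAt ℝ 1 z x) (h0 : z x ≠ 0) : ContDiffAt ℝ 1 (fun y => posEig (e y) (z y)) x :=
  ((he.pow 2).add (contDiff_normSq.contDiffAt.comp x hz)).sqrt
    (add_pos_of_nonneg_of_pos (sq_nonneg _) (Complex.normSq_pos.2 h0)).ne'

theorem ContDiffAt.rotNorm {e : E → ℝ} {z : E → ℂ} {x : E} (he : ContDiffAt ℝ 1 e x)
    (hz : ContDiffAt ℝ 1 z x) (h0 : z x ≠ 0) : ContDiffAt ℝ 1 (fun y => rotNorm (e y) (z y)) x :=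
  (((he.add (he.posEig hz h0)).pow 2).add (contDiff_normSq.contDiffAt.comp x hz)).sqrt
    (add_pos_of_nonneg_of_pos (sq_nonneg _) (Complex.normSq_pos.2 h0)).ne'

theorem MatrixC1At.rotBlocks {e : E → ℝ} {s : E → Fin (k + 1) → ℂ} {x : E}
    (he : ContDiffAt ℝ 1 e x) (hs : ∀ j, ContDiffAt ℝ 1 (fun y => s y j) x)
    (h0 : ∀ j, j ≠ Fin.last k → s x j ≠ 0) :
    MatrixC1At (fun y => rotBlocks (rotP (e y) (s y)) (rotQ (e y) (s y))) x := by
  have hp : ∀ j, ContDiffAt ℝ 1 (fun y => (rotP (e y) (s y) j : ℂ)) x := by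
    intro j
    refine contDiff_ofReal.contDiffAt.comp x ?_
    by_cases hj : j = Fin.last k
    · simpa only [rotP, if_pos hj] using contDiffAt_const
    · simp only [rotP, if_neg hj]
      exact (he.add (he.posEig (hs j) (h0 j hj))).div (he.rotNorm (hs j) (h0 j hj))
        (rotNorm_pos _ (h0 j hj)).ne'
  have hq : ∀ j, ContDiffAt ℝ 1 (fun y => rotQ (e y) (s y) j) x := by
    intro j
    by_cases hj : j = Fin.last k
    · simpa only [rotQ, if_pos hj] using contDiffAt_const
    · simp only [rotQ, if_neg hj, div_eq_mul_inv]
      refine (hs j).mul ((contDiff_ofReal.contDiffAt.comp x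
        (he.rotNorm (hs j) (h0 j hj))).inv ?_)
      exact Complex.ofReal_ne_zero.2 (rotNorm_pos _ (h0 j hj)).ne'
  exact MatrixC1At.fromBlocks (MatrixC1At.diagonal hp) (MatrixC1At.diagonal fun j => (hq j).neg)
    (MatrixC1At.diagonal fun j => contDiff_conj.contDiffAt.comp x (hq j)) (MatrixC1At.diagonal hp)

theorem MatrixC1At.middleBlock {e : E → ℝ} {z : E → ℂ} {x : E}
    (he : ContDiffAt ℝ 1 e x) (hz : ContDiffAt ℝ 1 z x) :
    MatrixC1At (fun y => middleBlock (e y) (z y)) x := by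
  have he' : ContDiffAt ℝ 1 (fun y => (e y : ℂ)) x := contDiff_ofReal.contDiffAt.comp x he
  intro i j
  fin_cases i <;> fin_cases j
  exacts [he', hz, contDiff_conj.contDiffAt.comp x hz, he'.neg]

/-- A local `C¹` singular value decomposition of `A` gives a block Schur decomposition of `M`. -/
theorem isBlockSchur_hermitianM {Ω : Set Plane} {A : Plane → Matrix (Fin (k + 1)) (Fin (k + 1)) ℂ}
    {U V : Plane → Matrix (Fin (k + 1)) (Fin (k + 1)) ℂ} {s : Plane → Fin (k + 1) → ℂ}
    {ξ₀ : Plane} {r : ℝ} (hr : 0 < r) (hΩ : Metric.ball ξ₀ r ⊆ Ω)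
    (hU : ∀ ξ ∈ Metric.ball ξ₀ r, MatrixC1At U ξ) (hV : ∀ ξ ∈ Metric.ball ξ₀ r, MatrixC1At V ξ)
    (hs : ∀ ξ ∈ Metric.ball ξ₀ r, ∀ j, ContDiffAt ℝ 1 (fun y => s y j) ξ)
    (hA : ∀ ξ ∈ Metric.ball ξ₀ r, IsPhasedSVD (A ξ) (U ξ) (V ξ) (s ξ))
    (hk : k + 1 < k + 1 + (k + 1)) :
    IsBlockSchur (Ω ×ˢ (Set.univ : Set ℝ)) (hermitianM A)
      (fun η _ => hermitianM_isHermitian A η) k hk (ξ₀, 0) (Metric.ball ξ₀ r ×ˢ Set.univ)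
      (fun η => (frame (U η.1) (V η.1) (rotP η.2 (s η.1)) (rotQ η.2 (s η.1))).submatrix id
        (blockEquiv k))
      (fun η => middleBlock η.2 (s η.1 (Fin.last k)))
      (fun η => diagonal fun i => ((eig (hermitianM_isHermitian A η) i.1 : ℝ) : ℂ)) := by
  have hU1 : ∀ η ∈ Metric.ball ξ₀ r ×ˢ (Set.univ : Set ℝ),
      ((frame (U η.1) (V η.1) (rotP η.2 (s η.1)) (rotQ η.2 (s η.1))).submatrix id
        (blockEquiv k))ᴴ * ((frame (U η.1) (V η.1) (rotP η.2 (s η.1))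
          (rotQ η.2 (s η.1))).submatrix id (blockEquiv k)) = 1 := by
    intro η hη
    rw [conjTranspose_submatrix, ← submatrix_mul _ _ _ _ _ Function.bijective_id,
      frame_unitary (hA η.1 hη.1) ((hA η.1 hη.1).isRotation η.2), submatrix_one_equiv]
  constructor
  · refine ⟨Metric.ball ξ₀.1 r, Metric.ball ξ₀.2 r, Set.univ, ?_, ?_, Set.ordConnected_univ, ?_⟩
    · rw [Real.ball_eq_Ioo]; exact Set.ordConnected_Ioo
    · rw [Real.ball_eq_Ioo]; exact Set.ordConnected_Ioo
    · rw [ball_prod_same]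
  · rw [IsOpen.interior_eq (Metric.isOpen_ball.prod isOpen_univ)]
    exact ⟨Metric.mem_ball_self hr, trivial⟩
  · intro i j η hη
    refine ContDiffAt.contDiffWithinAt ?_
    have hF : MatrixC1At (fun η : Space => fromBlocks (U η.1) 0 0 (V η.1)) η :=
      MatrixC1At.fromBlocks ((hU _ hη.1).comp contDiffAt_fst) (MatrixC1At.const 0)
        (MatrixC1At.const 0) ((hV _ hη.1).comp contDiffAt_fst)
    exact ((hF.mul (MatrixC1At.rotBlocks (e := fun η : Space => η.2) (s := fun η => s η.1)
      contDiffAt_snd (fun j => (hs _ hη.1 j).comp η contDiffAt_fst)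
      (fun j hj => (hA _ hη.1).ne_zero hj))).submatrix finSumFinEquiv.symm id) i (blockEquiv k j)
  · intro i j η hη
    exact (MatrixC1At.middleBlock (e := fun η : Space => η.2)
      (z := fun η => s η.1 (Fin.last k)) contDiffAt_snd
      ((hs _ hη.1 _).comp η contDiffAt_fst) i j).contDiffWithinAt
  · intro i j η hη
    -- On this set the remaining ordered eigenvalues are given by the formulas ±√(ε² + |s_x|²) with
    -- s_x ≠ 0, which are visibly C¹.
    have hcongr : ∀ η ∈ Metric.ball ξ₀ r ×ˢ (Set.univ : Set ℝ),
        (diagonal fun i : {i : Fin (k + 1 + (k + 1)) // (i : ℕ) ≠ k ∧ (i : ℕ) ≠ k + 1} =>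
          ((eig (hermitianM_isHermitian A η) i.1 : ℝ) : ℂ)) i j =
        (diagonal fun i : {i : Fin (k + 1 + (k + 1)) // (i : ℕ) ≠ k ∧ (i : ℕ) ≠ k + 1} =>
          (signedEig η.2 (s η.1) (ordEquiv (k + 1) i.1) : ℂ)) i j := by
      rintro ⟨ξ, ε⟩ hη
      simp only [eig_hermitianM (hA ξ hη.1)]
    refine ContDiffWithinAt.congr (ContDiffAt.contDiffWithinAt ?_) hcongr (hcongr η hη)
    refine MatrixC1At.diagonal (x := η) (fun i => contDiff_ofReal.contDiffAt.comp η ?_) i j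
    obtain ⟨x, hx, hi | hi⟩ := blockEquiv_inr_ne_last i
    · simp only [hi, signedEig, Sum.elim_inl]
      exact ContDiffAt.posEig contDiffAt_snd ((hs _ hη.1 _).comp η contDiffAt_fst)
        ((hA _ hη.1).ne_zero hx)
    · simp only [hi, signedEig, Sum.elim_inr]
      exact (ContDiffAt.posEig contDiffAt_snd ((hs _ hη.1 _).comp η contDiffAt_fst)
        ((hA _ hη.1).ne_zero hx)).neg
  · exact hU1
  · exact fun η hη => mul_conjTranspose_eq_one_of_equiv (middleEquiv k).symm (hU1 η hη)
  · rintro ⟨ξ, ε⟩ hη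
    have h := hA ξ hη.1
    simp only [eig_hermitianM h]
    rw [hermitianM_eq_frame h (h.isRotation ε), ← diagBlocks_submatrix, conjTranspose_submatrix,
      submatrix_mul_equiv, submatrix_mul_equiv, submatrix_id_id]
  · intros; rfl
  · rintro ⟨ξ, ε⟩ hη
    have h := hA ξ hη.1
    simp only [eig_hermitianM h]
    have e0 := blockEquiv_inl_zero k
    have e1 := blockEquiv_inl_one k
    rw [roots_charpoly_middleBlock]
    change _ = {((signedEig ε (s ξ) (blockEquiv k (Sum.inl 0)) : ℝ) : ℂ),
      ((signedEig ε (s ξ) (blockEquiv k (Sum.inl 1)) : ℝ) : ℂ)}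
    rw [e0, e1]
    rfl
  · exact Set.prod_mono hΩ subset_rfl

end Construction

/-! ### Regular zeros through kernels of derivatives. -/

theorem isRegularZero_iff {E G : Type*} [NormedAddCommGroup E] [NormedSpace ℝ E]
    [FiniteDimensional ℝ E] [NormedAddCommGroup G] [NormedSpace ℝ G] [FiniteDimensional ℝ G]
    (hEG : Module.finrank ℝ E = Module.finrank ℝ G) {F : E → G} {F' : E →L[ℝ] G} {x : E}
    (hF : HasFDerivAt F F' x) (h0 : F x = 0) :
    IsRegularZero F x ↔ ∀ v, F' v = 0 → v = 0 := by
  constructor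
  · rintro ⟨-, e, he⟩ v hv
    rw [hF.unique he] at hv
    exact e.injective (by simpa using hv)
  · intro h
    have hinj : Function.Injective (F' : E →ₗ[ℝ] G) :=
      (injective_iff_map_eq_zero (F' : E →ₗ[ℝ] G)).2 h
    refine ⟨h0, (LinearEquiv.ofInjectiveOfFinrankEq (F' : E →ₗ[ℝ] G) hinj
      hEG).toContinuousLinearEquiv, ?_⟩
    convert hF using 1
    ext v
    rfl

/-- The derivative of the coalescence map vanishes exactly where the derivative of the Hermitian
matrix function is a scalar matrix. -/
theorem isRegularZero_coalescenceMap_iff {P : Space → Matrix (Fin 2) (Fin 2) ℂ} {x : Space}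
    (hherm : ∀ᶠ y in 𝓝 x, (P y).IsHermitian) (h0 : P x = 0)
    {P' : Fin 2 → Fin 2 → Space →L[ℝ] ℂ}
    (hP : ∀ i j, HasFDerivAt (fun y => P y i j) (P' i j) x) :
    IsRegularZero (fun y => coalescenceMap (P y)) x ↔
      ∀ v, (∃ c : ℂ, (Matrix.of fun i j => P' i j v) = c • (1 : Matrix (Fin 2) (Fin 2) ℂ)) →
        v = 0 := by
  have hF : HasFDerivAt (fun y => coalescenceMap (P y))
      ((Complex.reCLM ∘L P' 0 0 - Complex.reCLM ∘L P' 1 1).prod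
        ((Complex.reCLM ∘L P' 0 1).prod (Complex.imCLM ∘L P' 0 1))) x :=
    ((Complex.reCLM.hasFDerivAt.comp x (hP 0 0)).sub
      (Complex.reCLM.hasFDerivAt.comp x (hP 1 1))).prodMk
      ((Complex.reCLM.hasFDerivAt.comp x (hP 0 1)).prodMk
        (Complex.imCLM.hasFDerivAt.comp x (hP 0 1)))
  -- P is Hermitian near x, so its derivative in any direction is Hermitian; this controls the
  -- entries that the coalescence map does not see.
  have hstar : ∀ i j v, P' i j v = star (P' j i v) := by
    intro i j v
    have h1 : HasFDerivAt (fun y => star (P y j i)) ((Complex.conjCLE : ℂ →L[ℝ] ℂ) ∘L P' j i) x :=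
      (Complex.conjCLE : ℂ →L[ℝ] ℂ).hasFDerivAt.comp x (hP j i)
    have h2 : HasFDerivAt (fun y => P y i j) ((Complex.conjCLE : ℂ →L[ℝ] ℂ) ∘L P' j i) x :=
      h1.congr_of_eventuallyEq (by
        filter_upwards [hherm] with y hy
        exact (hy.apply i j).symm)
    rw [(hP i j).unique h2]
    rfl
  have him : ∀ i v, (P' i i v).im = 0 := fun i v =>
    Complex.conj_eq_iff_im.1 (hstar i i v).symm
  rw [isRegularZero_iff (by simp) hF (by simp [coalescenceMap, h0])]
  refine forall_congr' fun v => imp_congr_left ?_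
  constructor
  · intro h
    simp only [ContinuousLinearMap.prod_apply, Prod.mk_eq_zero, _root_.sub_apply,
      ContinuousLinearMap.comp_apply, Complex.reCLM_apply, Complex.imCLM_apply] at h
    obtain ⟨h1, h2, h3⟩ := h
    have h01 : P' 0 1 v = 0 := Complex.ext h2 h3
    have h10 : P' 1 0 v = 0 := by rw [hstar, h01, star_zero]
    have h11 : P' 1 1 v = P' 0 0 v :=
      Complex.ext (sub_eq_zero.1 h1).symm (by rw [him, him])
    refine ⟨P' 0 0 v, ?_⟩
    ext i j
    fin_cases i <;> fin_cases j <;> simp [h01, h10, h11]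
  · rintro ⟨c, hc⟩
    have h00 : P' 0 0 v = c := by simpa using congrFun (congrFun hc 0) 0
    have h11 : P' 1 1 v = c := by simpa using congrFun (congrFun hc 1) 1
    have h01 : P' 0 1 v = 0 := by simpa using congrFun (congrFun hc 0) 1
    simp [h00, h11, h01]

theorem MatrixC1On.matrixC1At {E : Type*} [NormedAddCommGroup E] [NormedSpace ℝ E]
    {ι κ : Type*} {R : Set E} {A : E → Matrix ι κ ℂ} (h : MatrixC1On R A) {x : E}
    (hx : R ∈ 𝓝 x) : MatrixC1At A x :=
  fun i j => (h i j).contDiffAt hx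

/-! ### Independence of the choice of block Schur decomposition. -/

namespace IsBlockSchur

variable {m : ℕ} {Ω : Set Space} {B : Space → Matrix (Fin m) (Fin m) ℂ}
  {hB : ∀ ξ ∈ Ω, (B ξ).IsHermitian} {h : ℕ} {hh : h + 1 < m} {x : Space} {R R₀ : Set Space}
  {U U₀ : Space → Matrix (Fin m) (Fin 2 ⊕ {i : Fin m // (i : ℕ) ≠ h ∧ (i : ℕ) ≠ h + 1}) ℂ}
  {P P₀ : Space → Matrix (Fin 2) (Fin 2) ℂ}
  {L L₀ : Space → Matrix {i : Fin m // (i : ℕ) ≠ h ∧ (i : ℕ) ≠ h + 1}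
      {i : Fin m // (i : ℕ) ≠ h ∧ (i : ℕ) ≠ h + 1} ℂ}

theorem mem_nhds (S : IsBlockSchur Ω B hB h hh x R U P L) : R ∈ 𝓝 x :=
  mem_interior_iff_mem_nhds.1 S.mem_interior

theorem isHermitian_P (S : IsBlockSchur Ω B hB h hh x R U P L) {y : Space} (hy : y ∈ R) :
    (P y).IsHermitian := by
  have h1 : fromBlocks (P y) 0 0 (L y) = (U y)ᴴ * B y * U y := by
    rw [S.decomp y hy, Matrix.mul_assoc, Matrix.mul_assoc, S.unitary_left y hy, Matrix.mul_one,
      ← Matrix.mul_assoc, S.unitary_left y hy, Matrix.one_mul]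
  have h2 : (fromBlocks (P y) 0 0 (L y)).IsHermitian := by
    rw [h1]
    exact isHermitian_conjTranspose_mul_mul _ (hB y (S.subset hy))
  exact (isHermitian_fromBlocks_iff.1 h2).1

/-- P is Hermitian, hence zero once both its eigenvalues are. -/
theorem P_eq_zero (S : IsBlockSchur Ω B hB h hh x R U P L) (hx : x ∈ Ω)
    (h0 : eig (hB x hx) ⟨h, Nat.lt_of_succ_lt hh⟩ = 0) (h1 : eig (hB x hx) ⟨h + 1, hh⟩ = 0) :
    P x = 0 := by
  have hxR := mem_of_mem_nhds S.mem_nhds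
  have hr := S.eig_P x hxR
  rw [h0, h1] at hr
  have hherm := S.isHermitian_P hxR
  have hr2 := hherm.roots_charpoly_eq_eigenvalues
  refine hherm.eigenvalues_eq_zero_iff.1 ?_
  ext i
  have hm : ((hherm.eigenvalues i : ℝ) : ℂ) ∈ (P x).charpoly.roots := by
    rw [hr2]
    exact Multiset.mem_map_of_mem _ (Finset.mem_univ i)
  rw [hr] at hm
  simpa using hm

/-- The `2 × 2` blocks of two block Schur decompositions are regular at the same time. -/
theorem isRegularZero_of (S : IsBlockSchur Ω B hB h hh x R U P L)
    (S₀ : IsBlockSchur Ω B hB h hh x R₀ U₀ P₀ L₀) (hx : x ∈ Ω)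
    (h0 : eig (hB x hx) ⟨h, Nat.lt_of_succ_lt hh⟩ = 0) (h1 : eig (hB x hx) ⟨h + 1, hh⟩ = 0)
    (hne : ∀ i : Fin m, (i : ℕ) ≠ h ∧ (i : ℕ) ≠ h + 1 → eig (hB x hx) i ≠ 0)
    (hreg : IsRegularZero (fun y => coalescenceMap (P₀ y)) x) :
    IsRegularZero (fun y => coalescenceMap (P y)) x := by
  have hPx := S.P_eq_zero hx h0 h1
  have hP₀x := S₀.P_eq_zero hx h0 h1
  have hxR := mem_of_mem_nhds S.mem_nhds
  have hxR₀ := mem_of_mem_nhds S₀.mem_nhds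
  -- The transition matrix intertwines the two block diagonal forms of B.
  let X : Space → Matrix (Fin 2 ⊕ {i : Fin m // (i : ℕ) ≠ h ∧ (i : ℕ) ≠ h + 1})
    (Fin 2 ⊕ {i : Fin m // (i : ℕ) ≠ h ∧ (i : ℕ) ≠ h + 1}) ℂ := fun y => (U₀ y)ᴴ * U y
  have hXC : MatrixC1At X x :=
    (S₀.smooth_U.matrixC1At S₀.mem_nhds).conjTranspose.mul (S.smooth_U.matrixC1At S.mem_nhds)
  have hX : ∀ y ∈ R, y ∈ R₀ →
      X y * fromBlocks (P y) 0 0 (L y) = fromBlocks (P₀ y) 0 0 (L₀ y) * X y := by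
    intro y hy hy₀
    have e1 : B y * U y = U y * fromBlocks (P y) 0 0 (L y) := by
      rw [S.decomp y hy, Matrix.mul_assoc, S.unitary_left y hy, Matrix.mul_one]
    have e2 : (U₀ y)ᴴ * B y = fromBlocks (P₀ y) 0 0 (L₀ y) * (U₀ y)ᴴ := by
      rw [S₀.decomp y hy₀, Matrix.mul_assoc, ← Matrix.mul_assoc, S₀.unitary_left y hy₀,
        Matrix.one_mul]
    simp only [X]
    rw [Matrix.mul_assoc, ← e1, ← Matrix.mul_assoc, e2, Matrix.mul_assoc]
  have hX11 : ∀ y ∈ R, y ∈ R₀ → (X y).toBlocks₁₁ * P y = P₀ y * (X y).toBlocks₁₁ := by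
    intro y hy hy₀
    have := hX y hy hy₀
    rw [← fromBlocks_toBlocks (X y), fromBlocks_multiply, fromBlocks_multiply] at this
    simpa using (fromBlocks_inj.1 this).1
  -- At x the off-diagonal block satisfies X₁₂ L = P₀ X₁₂ = 0, and L is diagonal with nonzero
  -- entries. Hence X₁₁ inherits unitarity from X.
  have hX12 : (X x).toBlocks₁₂ = 0 := by
    have := hX x hxR hxR₀
    rw [← fromBlocks_toBlocks (X x), fromBlocks_multiply, fromBlocks_multiply, hPx, hP₀x] at this
    have h12 := (fromBlocks_inj.1 this).2.1
    rw [S.eig_L x hxR] at h12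
    ext i j
    have h3 := congrFun (congrFun h12 i) j
    simp only [Matrix.mul_zero, Matrix.zero_mul, zero_add, add_zero, mul_diagonal,
      Matrix.zero_apply] at h3
    exact (mul_eq_zero.1 h3).resolve_right (Complex.ofReal_ne_zero.2 (hne j.1 j.2))
  have hunit : (X x).toBlocks₁₁ * ((X x).toBlocks₁₁)ᴴ = 1 := by
    have hu : X x * (X x)ᴴ = 1 := by
      simp only [X]
      rw [conjTranspose_mul, conjTranspose_conjTranspose, Matrix.mul_assoc,
        ← Matrix.mul_assoc (U x), S.unitary_right x hxR, Matrix.one_mul, S₀.unitary_left x hxR₀]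
    rw [← fromBlocks_toBlocks (X x), fromBlocks_conjTranspose, fromBlocks_multiply,
      ← fromBlocks_one] at hu
    have := (fromBlocks_inj.1 hu).1
    rwa [hX12, Matrix.zero_mul, add_zero] at this
  have hunit' := mul_eq_one_comm.1 hunit
  set Y := (X x).toBlocks₁₁ with hY
  have hPd : ∀ i j, HasFDerivAt (fun y => P y i j) (fderiv ℝ (fun y => P y i j) x) x := fun i j =>
    ((S.smooth_P.matrixC1At S.mem_nhds i j).differentiableAt (by simp)).hasFDerivAt
  have hP₀d : ∀ i j, HasFDerivAt (fun y => P₀ y i j) (fderiv ℝ (fun y => P₀ y i j) x) x :=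
    fun i j =>
      ((S₀.smooth_P.matrixC1At S₀.mem_nhds i j).differentiableAt (by simp)).hasFDerivAt
  have hXd : ∀ i j, HasFDerivAt (fun y => X y i j) (fderiv ℝ (fun y => X y i j) x) x := fun i j =>
    ((hXC i j).differentiableAt (by simp)).hasFDerivAt
  have hherm : ∀ᶠ y in 𝓝 x, (P y).IsHermitian := by
    filter_upwards [S.mem_nhds] with y hy using S.isHermitian_P hy
  have hherm₀ : ∀ᶠ y in 𝓝 x, (P₀ y).IsHermitian := by
    filter_upwards [S₀.mem_nhds] with y hy using S₀.isHermitian_P hy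
  rw [isRegularZero_coalescenceMap_iff hherm₀ hP₀x hP₀d] at hreg
  rw [isRegularZero_coalescenceMap_iff hherm hPx hPd]
  rintro v ⟨c, hc⟩
  refine hreg v ⟨c, ?_⟩
  -- Differentiate X₁₁ P = P₀ X₁₁ at x: the terms with the derivative of X drop out since P and P₀
  -- vanish there.
  have hderiv : Y * (Matrix.of fun i j => fderiv ℝ (fun y => P y i j) x v)
      = (Matrix.of fun i j => fderiv ℝ (fun y => P₀ y i j) x v) * Y := by
    ext i j
    have d1 := HasFDerivAt.fun_sum (u := Finset.univ) fun l (_ : l ∈ Finset.univ) =>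
      (hXd (Sum.inl i) (Sum.inl l)).mul (hPd l j)
    have d2 := HasFDerivAt.fun_sum (u := Finset.univ) fun l (_ : l ∈ Finset.univ) =>
      (hP₀d i l).mul (hXd (Sum.inl l) (Sum.inl j))
    have heq : (fun y => ∑ l, X y (Sum.inl i) (Sum.inl l) * P y l j) =ᶠ[𝓝 x]
        fun y => ∑ l, P₀ y i l * X y (Sum.inl l) (Sum.inl j) := by
      filter_upwards [S.mem_nhds, S₀.mem_nhds] with y hy hy₀
      exact congrFun (congrFun (hX11 y hy hy₀) i) j
    have := congrArg (fun f => f v) ((d1.congr_of_eventuallyEq heq.symm).unique d2)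
    simpa [hPx, hP₀x, Matrix.mul_apply, hY, toBlocks₁₁, mul_comm] using this
  calc (Matrix.of fun i j => fderiv ℝ (fun y => P₀ y i j) x v)
      = (Matrix.of fun i j => fderiv ℝ (fun y => P₀ y i j) x v) * (Y * Yᴴ) := by
        rw [hunit, Matrix.mul_one]
    _ = Y * (c • 1) * Yᴴ := by rw [← Matrix.mul_assoc, ← hderiv, hc]
    _ = c • 1 := by rw [mul_smul_one, smul_mul, hunit]

end IsBlockSchur

/-! ### Reduction of both conditions to the derivative of the last s_j. -/

/-- The middle block is regular exactly where its off-diagonal entry is. -/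
theorem isRegularZero_middleBlock_iff {z : Plane → ℂ} {z' : Plane →L[ℝ] ℂ} {ξ : Plane}
    (hz : HasFDerivAt z z' ξ) (h0 : z ξ = 0) :
    IsRegularZero (fun η : Space => coalescenceMap (middleBlock η.2 (z η.1))) (ξ, 0) ↔
      ∀ w, z' w = 0 → w = 0 := by
  have hfst : HasFDerivAt (fun η : Space => z η.1) (z' ∘L .fst ℝ Plane ℝ) (ξ, 0) :=
    HasFDerivAt.comp (ξ, (0 : ℝ)) (f := Prod.fst) (g := z) hz hasFDerivAt_fst
  -- The doubled projection comes from a - d = ε - (-ε) = 2ε.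
  have hF : HasFDerivAt (fun η : Space => coalescenceMap (middleBlock η.2 (z η.1)))
      (((ContinuousLinearMap.snd ℝ Plane ℝ) + (ContinuousLinearMap.snd ℝ Plane ℝ)).prod
        ((Complex.reCLM ∘L (z' ∘L .fst ℝ Plane ℝ)).prod
          (Complex.imCLM ∘L (z' ∘L .fst ℝ Plane ℝ)))) (ξ, 0) := by
    have h := (HasFDerivAt.add (hasFDerivAt_snd (𝕜 := ℝ) (p := (ξ, (0 : ℝ))))
      hasFDerivAt_snd).prodMk
      ((Complex.reCLM.hasFDerivAt.comp (ξ, (0 : ℝ)) hfst).prodMk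
        (Complex.imCLM.hasFDerivAt.comp (ξ, (0 : ℝ)) hfst))
    refine h.congr_of_eventuallyEq (Eventually.of_forall fun η => ?_)
    simp [coalescenceMap, middleBlock]
  rw [isRegularZero_iff (by simp) hF (by simp [coalescenceMap, middleBlock, h0])]
  constructor
  · intro h w hw
    have := h (w, 0) (by simp [hw])
    exact congrArg Prod.fst this
  · rintro h ⟨w, e⟩ hv
    simp only [ContinuousLinearMap.prod_apply, Prod.mk_eq_zero, _root_.add_apply,
      ContinuousLinearMap.comp_apply, Complex.reCLM_apply, Complex.imCLM_apply,
      ContinuousLinearMap.coe_fst', ContinuousLinearMap.coe_snd'] at hv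
    obtain ⟨h1, h2, h3⟩ := hv
    have hw := h w (Complex.ext h2 h3)
    have he : e = 0 := by linarith
    rw [hw, he]
    rfl

/-- A complex valued function is a regular zero together with its product by a nonzero factor. -/
theorem isRegularZero_re_im_mul_iff {f g z : Plane → ℂ} {z' : Plane →L[ℝ] ℂ} {ξ : Plane}
    (hz : HasFDerivAt z z' ξ) (h0 : z ξ = 0) (hg : DifferentiableAt ℝ g ξ) (hg0 : g ξ ≠ 0)
    (hf : ∀ᶠ y in 𝓝 ξ, f y = g y * z y) :
    IsRegularZero (fun y => (((f y).re, (f y).im) : ℝ × ℝ)) ξ ↔ ∀ w, z' w = 0 → w = 0 := by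
  -- The term of the product rule with the derivative of g is multiplied by z(ξ) = 0.
  have hf' : HasFDerivAt f (g ξ • z') ξ := by
    have := (hg.hasFDerivAt.mul hz).congr_of_eventuallyEq hf
    refine this.congr_fderiv (ContinuousLinearMap.ext fun w => ?_)
    simp [h0]
  have hF : HasFDerivAt (fun y => (((f y).re, (f y).im) : ℝ × ℝ))
      ((Complex.reCLM ∘L (g ξ • z')).prod (Complex.imCLM ∘L (g ξ • z'))) ξ :=
    (Complex.reCLM.hasFDerivAt.comp ξ hf').prodMk (Complex.imCLM.hasFDerivAt.comp ξ hf')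
  have hf0 : f ξ = 0 := by rw [hf.self_of_nhds, h0, mul_zero]
  rw [isRegularZero_iff rfl hF (by simp [hf0])]
  refine forall_congr' fun w => imp_congr_left ?_
  have : (((Complex.reCLM ∘L (g ξ • z')).prod (Complex.imCLM ∘L (g ξ • z'))) w = 0) ↔
      g ξ * z' w = 0 := by
    rw [Complex.ext_iff]
    exact Prod.mk_eq_zero
  rw [this, mul_eq_zero, or_iff_right hg0]

theorem theorem3p2 {n : ℕ} (hn : 2 ≤ n) (Ω : Set Plane) (hΩ : IsOpen Ω)
    (A : Plane → Matrix (Fin n) (Fin n) ℂ) (hA : MatrixC1On Ω A)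
    (hσ : ∀ ξ ∈ Ω, Function.Injective (singVal (A ξ)))
    (ξ₀ : Plane) (hξ₀ : ξ₀ ∈ Ω) (hrank : ∀ ξ ∈ Ω, (A ξ).rank < n ↔ ξ = ξ₀) :
    IsGenericLossOfRank A ξ₀ ↔
      IsGenericCoalescence (Ω ×ˢ (Set.univ : Set ℝ)) (hermitianM A)
        (fun η _ => hermitianM_isHermitian A η) (ξ₀, 0) := by
  obtain ⟨k, rfl⟩ : ∃ k, n = k + 1 := ⟨n - 1, by omega⟩
  have hC1 : ∀ ξ ∈ Ω, MatrixC1At A ξ := fun ξ hξ => hA.matrixC1At (hΩ.mem_nhds hξ)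
  have hcoal := coalesceOnlyAt_hermitianM (fun ξ hξ => by
    obtain ⟨U, V, s, -, -, -, h⟩ := exists_local_phasedSVD (hC1 ξ hξ) (hσ ξ hξ)
    exact ⟨_, _, _, h.self_of_nhds⟩) hrank
  obtain ⟨U, V, s, hU, hV, hs, hsvd⟩ := exists_local_phasedSVD (hC1 ξ₀ hξ₀) (hσ ξ₀ hξ₀)
  have hsvd₀ := hsvd.self_of_nhds
  have hs₀ : s ξ₀ (Fin.last k) = 0 := hsvd₀.rank_lt_iff.1 ((hrank ξ₀ hξ₀).2 rfl)
  obtain ⟨r, hr, hball⟩ := Metric.eventually_nhds_iff_ball.1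
    ((hΩ.eventually_mem hξ₀).and (hU.eventually.and (hV.eventually.and
      ((eventually_all.2 fun j => (hs j).eventually (by simp)).and hsvd))))
  have hk : k + 1 < k + 1 + (k + 1) := by omega
  have S₀ := isBlockSchur_hermitianM hr (fun ξ hξ => (hball ξ hξ).1)
    (fun ξ hξ => (hball ξ hξ).2.1) (fun ξ hξ => (hball ξ hξ).2.2.1)
    (fun ξ hξ => (hball ξ hξ).2.2.2.1) (fun ξ hξ => (hball ξ hξ).2.2.2.2) hk
  have hz := ((hs (Fin.last k)).differentiableAt (by simp)).hasFDerivAt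
  have hg : IsGenericLossOfRank A ξ₀ ↔
      IsRegularZero (fun η : Space => coalescenceMap (middleBlock η.2 (s η.1 (Fin.last k))))
        (ξ₀, 0) := by
    rw [isRegularZero_middleBlock_iff hz hs₀]
    -- This g is det A with the factor s_n removed from det U · det V* · ∏ s_j.
    refine isRegularZero_re_im_mul_iff (g := fun y => (U y).det * (V y)ᴴ.det *
      ∏ j : Fin k, s y j.castSucc) hz hs₀ ?_ ?_ ?_
    · exact ((hU.det.mul hV.conjTranspose.det).mul
        (contDiffAt_prod fun j _ => hs j.castSucc)).differentiableAt (by simp)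
    · refine mul_ne_zero (mul_ne_zero ?_ ?_) (Finset.prod_ne_zero_iff.2 fun j _ =>
        hsvd₀.ne_zero (Fin.castSucc_lt_last j).ne)
      · exact (isUnit_det_of_left_inverse hsvd₀.left).ne_zero
      · exact (isUnit_det_of_right_inverse hsvd₀.right).ne_zero
    · filter_upwards [hsvd] with y hy
      rw [hy.eq, det_mul, det_mul, det_diagonal, Fin.prod_univ_castSucc]
      ring
  have hη₀ : ((ξ₀, 0) : Space) ∈ Ω ×ˢ (Set.univ : Set ℝ) := ⟨hξ₀, trivial⟩
  have hzero : ∀ x : Fin 2, eig (hermitianM_isHermitian A (ξ₀, 0))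
      (middleEquiv k (Sum.inl x)) = 0 := by
    intro x
    rw [eig_hermitianM hsvd₀]
    change signedEig 0 (s ξ₀) (blockEquiv k (Sum.inl x)) = 0
    fin_cases x
    · simp [blockEquiv_inl_zero, signedEig, posEig, hs₀]
    · simp [blockEquiv_inl_one, signedEig, posEig, hs₀]
  have hne : ∀ i : Fin (k + 1 + (k + 1)), (i : ℕ) ≠ k ∧ (i : ℕ) ≠ k + 1 →
      eig (hermitianM_isHermitian A (ξ₀, 0)) i ≠ 0 := by
    intro i hi
    rw [eig_hermitianM hsvd₀]
    obtain ⟨x, hx, h | h⟩ := blockEquiv_inr_ne_last ⟨i, hi⟩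
    · rw [h]
      exact (posEig_pos 0 (hsvd₀.ne_zero hx)).ne'
    · rw [h]
      exact (neg_neg_of_pos (posEig_pos 0 (hsvd₀.ne_zero hx))).ne
  rw [hg]
  constructor
  · intro hreg
    -- As n ≥ 2, the size 2n exceeds 2, so the clause for m = 2 is vacuous.
    refine ⟨hη₀, k, hk, hcoal, fun hm => by omega, fun _ => ⟨⟨_, _, _, _, S₀⟩, ?_⟩⟩
    intro R U' P L S
    exact S.isRegularZero_of S₀ hη₀ (hzero 0) (hzero 1) hne hreg
  · rintro ⟨-, h, hh, hcoal', -, hS⟩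
    -- The middle pair does coalesce at (ξ₀, 0), so the given index can only be k and the explicit
    -- decomposition `S₀` is admissible.
    obtain rfl : k = h :=
      ((hcoal' k hk (ξ₀, 0) hη₀).1 ((hcoal k hk (ξ₀, 0) hη₀).2 ⟨rfl, rfl⟩)).1
    exact (hS (by omega)).2 _ _ _ _ S₀

end
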